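/- **Setting.** Let $X$ be a proper geodesic metric space and $\delta\ge 0$. Put $(x|y)_w=\frac12\big(d(w,x)+d(w,y)-d(x,y)\big)$; $X$ is $\delta$-hyperbolic if $(x|z)_w\ge\min\{(x|y)_w,(y|z)_w\}-\delta$ for all $w,x,y,z\in X$. The ideal boundary $\partial X$ consists of the classes of sequences $(x_i)$ with $(x_i|x_j)_w\to\infty$ as $i,j\to\infty$, where $(x_i)\sim(y_i)$ if $(x_i|y_j)_w\to\infty$ as $i,j\to\infty$; a sequence converges to its class. For $\xi,\eta\in\partial X$ let $(\xi|\eta)_p=\sup\liminf_{i,j\to\infty}(x_i|y_j)_p\in[0,\infty]$, the supremum being over all sequences $x_i\to\xi$, $y_j\to\eta$. The sets $\{\zeta:(\xi|\zeta)_p>R\}$, $R\in\mathbb R$, are the basic neighbourhoods of $\xi$ in $\partial X$. Let $\xi\in\partial X$, $p\in X$, $\epsilon>0$. For a geodesic ray $\gamma$ from $p$ to $\xi$ let $B_\gamma(x)=\lim_{t\to\infty}(d(\gamma(t),x)-t)$, let $B_{\xi,p}(x)$ be the supremum of $B_\gamma(x)$ over all such rays, and for $\eta_1\ne\eta_2$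 in $\partial X\setminus\{\xi\}$ let $H_{\xi,p}(\eta_1,\eta_2)$ be the infimum of $B_{\xi,p}$ over all points of all complete geodesics from $\eta_1$ to $\eta_2$. * A *visual metric* $d_{p,\epsilon}$ is a metric on $\partial X$ with $\frac12e^{-\epsilon(\eta_1|\eta_2)_p}\le d_{p,\epsilon}(\eta_1,\eta_2)\le e^{-\epsilon(\eta_1|\eta_2)_p}$ for all $\eta_1,\eta_2\in\partial X$ (with $e^{-\infty}=0$). * A *parabolic visual metric* $d_{\xi,p,\epsilon}$ is a metric on $\partial X\setminus\{\xi\}$ with $\frac12e^{-\epsilon H_{\xi,p}(\eta_1,\eta_2)}\le d_{\xi,p,\epsilon}(\eta_1,\eta_2)\le e^{-\epsilon H_{\xi,p}(\eta_1,\eta_2)}$ for all $\eta_1\ne\eta_2$. * A *metric inversion* of a metric space $(Y,d)$ at $q\in Y$ is a metric $d_q$ on $Y\setminus\{q\}$ with $\frac{d(x,y)}{4d(x,q)d(y,q)}\le d_q(x,y)\le\frac{d(x,y)}{d(x,q)d(y,q)}$. * A *sphericalization* of $(Y,d)$ at $q\in Y$ is a metric $\widehat d_q$ on $S_q(Y)=Y\cup\{\infty\}$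 with $\frac14s_q\le\widehat d_q\le s_q$, where $s_q$ is symmetric, $s_q(x,y)=\frac{d(x,y)}{(1+d(x,q))(1+d(y,q))}$ and $s_q(x,\infty)=\frac1{1+d(x,q)}$ for $x,y\in Y$, and $s_q(\infty,\infty)=0$. A map $f$ is $L$-bilipschitz if $L^{-1}d(x,y)\le d(f(x),f(y))\le L\,d(x,y)$ for all $x,y$. **Proposition 5.4.** Let $\delta\ge0$. There is $\epsilon_0>0$, depending only on $\delta$, such that for every $\delta$-hyperbolic proper geodesic metric space $X$, all $\xi\in\partial X$, $p\in X$ and $0<\epsilon\le\epsilon_0$ there exist a visual metric $d_{p,\epsilon}$ and a parabolic visual metric $d_{\xi,p,\epsilon}$. Moreover, for every $\epsilon_0>0$ there is a constant $L\ge1$, depending only on $\delta$ and $\epsilon_0$ (hence only on $\delta$ if $\epsilon_0$ is chosen in terms of $\delta$), such that for every such $X$, all $\xi\in\partial X$, $p\in X$, $0<\epsilon\le\epsilon_0$, and all such metrics $d_{p,\epsilon}$ and $d_{\xi,p,\epsilon}$: 1. A metric inversion $(d_{p,\epsilon})_\xi$ of $(\partial X,d_{p,\epsilon})$ at $\xi$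 exists, and for every such inversion the identity map $(\partial X\setminus\{\xi\},d_{\xi,p,\epsilon})\to(\partial X\setminus\{\xi\},(d_{p,\epsilon})_\xi)$ is $L$-bilipschitz. 2. Suppose that $\xi$ is non-isolated in $\partial X$ and let $\eta\in\partial X\setminus\{\xi\}$. Then $(\partial X\setminus\{\xi\},d_{\xi,p,\epsilon})$ is unbounded and has a sphericalization at $\eta$, and for every sphericalization $\widehat{(d_{\xi,p,\epsilon})}_\eta$ at $\eta$ the bijection $$f:(\partial X,d_{p,\epsilon})\to\big(S_\eta(\partial X\setminus\{\xi\}),\widehat{(d_{\xi,p,\epsilon})}_\eta\big)$$ that is the identity on $\partial X\setminus\{\xi\}$ and maps $\xi$ to $\infty$ is bilipschitz (that is, $L'$-bilipschitz for some $L'\ge1$). -/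

import Mathlib

open Filter Topology
open scoped NNReal ENNReal

noncomputable section

namespace ParabolicVisual

universe u

section Space

variable {X : Type u} [MetricSpace X]

/-- The Gromov product `(x|y)_w = (d(w,x) + d(w,y) - d(x,y)) / 2` of two points of `X`. -/
def gromovProd (w x y : X) : ℝ := (dist w x + dist w y - dist x y) / 2

/-- `X` is `δ`-hyperbolic (in the sense of Gromov). -/
def IsHyperbolic (X : Type u) [MetricSpace X] (δ : ℝ) : Prop :=
  ∀ w x y z : X, min (gromovProd w x y) (gromovProd w y z) - δ ≤ gromovProd w x z

/-- Any two points of `X` are joined by a geodesic segment. -/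
def IsGeodesicSpace (X : Type u) [MetricSpace X] : Prop :=
  ∀ x y : X, ∃ γ : ℝ → X, γ 0 = x ∧ γ (dist x y) = y ∧
    ∀ s ∈ Set.Icc 0 (dist x y), ∀ t ∈ Set.Icc 0 (dist x y), dist (γ s) (γ t) = |s - t|

/-- `(x_i|y_j)_w → ∞` as `i, j → ∞` (for every base point `w`; as changing the base point changes
Gromov products by a bounded amount, one base point would be enough). -/
def Asymptotic (x y : ℕ → X) : Prop :=
  ∀ w : X, Tendsto (fun n : ℕ × ℕ => gromovProd w (x n.1) (y n.2)) atTop atTop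

/-- The sequences in `X` that converge at infinity: `(x_i|x_j)_w → ∞` as `i, j → ∞`. -/
def SeqAtInfinity (X : Type u) [MetricSpace X] : Type u := {x : ℕ → X // Asymptotic x x}

/-- The ideal boundary `∂X`: sequences converging at infinity, two of them being identified when
`(x_i|y_j)_w → ∞`. For hyperbolic `X` this relation is an equivalence relation, see
`IsHyperbolic.equivalence` below. -/
def Boundary (X : Type u) [MetricSpace X] : Type u :=
  Quot (fun x y : SeqAtInfinity X => Asymptotic x.1 y.1)

/-- The sequence `x` in `X` converges to the boundary point `ξ`. -/
def ConvergesTo (x : ℕ → X) (ξ : Boundary X) : Prop :=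
  ∃ h : Asymptotic x x, Quot.mk _ (⟨x, h⟩ : SeqAtInfinity X) = ξ

theorem gromovProd_comm (w x y : X) : gromovProd w x y = gromovProd w y x := by
  unfold gromovProd
  rw [dist_comm x y]
  ring

theorem Asymptotic.symm {x y : ℕ → X} (hxy : Asymptotic x y) : Asymptotic y x := by
  intro w
  have hs : Tendsto (Prod.swap : ℕ × ℕ → ℕ × ℕ) atTop atTop := by
    rw [← prod_atTop_atTop_eq]
    exact tendsto_prod_swap
  refine ((hxy w).comp hs).congr fun n => ?_
  simp [gromovProd_comm w (x n.2) (y n.1)]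

theorem IsHyperbolic.asymptotic_trans {δ : ℝ} (h : IsHyperbolic X δ) {x y z : ℕ → X}
    (hxy : Asymptotic x y) (hyz : Asymptotic y z) : Asymptotic x z := by
  intro w
  refine tendsto_atTop.2 fun M => ?_
  have h1 := tendsto_atTop.1 (hxy w) (M + δ)
  have h2 := tendsto_atTop.1 (hyz w) (M + δ)
  obtain ⟨a, ha⟩ := eventually_atTop.1 h1
  obtain ⟨b, hb⟩ := eventually_atTop.1 h2
  refine eventually_atTop.2 ⟨(a.1, b.2), fun n hn => ?_⟩
  have e1 := ha (n.1, max a.2 b.1) ⟨hn.1, le_max_left _ _⟩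
  have e2 := hb (max a.2 b.1, n.2) ⟨le_max_right _ _, hn.2⟩
  have e3 := h w (x n.1) (y (max a.2 b.1)) (z n.2)
  have e4 := le_min e1 e2
  linarith

theorem IsHyperbolic.equivalence {δ : ℝ} (h : IsHyperbolic X δ) :
    Equivalence (fun x y : SeqAtInfinity X => Asymptotic x.1 y.1) :=
  ⟨fun x => x.2, fun hxy => hxy.symm, fun hxy hyz => h.asymptotic_trans hxy hyz⟩

/-- The Gromov product `(ξ|η)_p = sup liminf (x_i|y_j)_p` of two boundary points, the supremum
being over all sequences `x_i → ξ` and `y_j → η`, as an extended real (it is `∞` for `ξ = η`). -/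
def boundaryProd (p : X) (ξ η : Boundary X) : EReal :=
  ⨆ (x : ℕ → X) (y : ℕ → X) (_ : ConvergesTo x ξ) (_ : ConvergesTo y η),
    liminf (fun n : ℕ × ℕ => (gromovProd p (x n.1) (y n.2) : EReal)) atTop

/-- `γ : [0, ∞) → X` is a geodesic ray from `p` to `ξ`. -/
def IsRay (γ : ℝ≥0 → X) (p : X) (ξ : Boundary X) : Prop :=
  Isometry γ ∧ γ 0 = p ∧ ConvergesTo (fun n : ℕ => γ n) ξ

/-- `σ : ℝ → X` is a complete geodesic from `η₁` to `η₂`. -/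
def IsCompleteGeodesic (σ : ℝ → X) (η₁ η₂ : Boundary X) : Prop :=
  Isometry σ ∧ ConvergesTo (fun n : ℕ => σ (-n)) η₁ ∧ ConvergesTo (fun n : ℕ => σ n) η₂

/-- `B_γ(x) = lim_{t → ∞} (d(γ(t), x) - t)` for a ray `γ`. -/
def rayBusemann (γ : ℝ≥0 → X) (x : X) : ℝ :=
  limUnder atTop (fun t : ℝ≥0 => dist (γ t) x - (t : ℝ))

/-- The Busemann function `B_{ξ,p}(x) = sup {B_γ(x) : γ a geodesic ray from p to ξ}`. -/
def busemann (ξ : Boundary X) (p x : X) : ℝ :=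
  sSup {b : ℝ | ∃ γ : ℝ≥0 → X, IsRay γ p ξ ∧ b = rayBusemann γ x}

/-- `H_{ξ,p}(η₁, η₂)`: the infimum of `B_{ξ,p}` over all points of all complete geodesics from
`η₁` to `η₂`. -/
def height (ξ : Boundary X) (p : X) (η₁ η₂ : Boundary X) : EReal :=
  ⨅ (σ : ℝ → X) (_ : IsCompleteGeodesic σ η₁ η₂) (t : ℝ), (busemann ξ p (σ t) : EReal)

/-- `e^{-ε a}` for `a` in `[-∞, ∞]`; in particular it is `0` for `a = ∞` and `ε > 0`. -/
def expNeg (ε : ℝ) (a : EReal) : ℝ := (EReal.exp (-((ε : EReal) * a))).toReal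

/-- `d` is a visual metric `d_{p,ε}` on `∂X`. -/
def IsVisualMetric (p : X) (ε : ℝ) (d : MetricSpace (Boundary X)) : Prop :=
  ∀ η₁ η₂ : Boundary X,
    1 / 2 * expNeg ε (boundaryProd p η₁ η₂) ≤ d.dist η₁ η₂ ∧
      d.dist η₁ η₂ ≤ expNeg ε (boundaryProd p η₁ η₂)

/-- `d` is a parabolic visual metric `d_{ξ,p,ε}` on `∂X ∖ {ξ}`: it satisfies
`D_{ξ,p,ε} / 2 ≤ d ≤ D_{ξ,p,ε}`, where `D_{ξ,p,ε}(η₁, η₂) = e^{-ε H_{ξ,p}(η₁, η₂)}` for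
`η₁ ≠ η₂`. -/
def IsParabolicVisualMetric (ξ : Boundary X) (p : X) (ε : ℝ)
    (d : MetricSpace {η : Boundary X // η ≠ ξ}) : Prop :=
  ∀ η₁ η₂ : {η : Boundary X // η ≠ ξ}, η₁ ≠ η₂ →
    1 / 2 * expNeg ε (height ξ p η₁ η₂) ≤ d.dist η₁ η₂ ∧
      d.dist η₁ η₂ ≤ expNeg ε (height ξ p η₁ η₂)

/-- `ξ` is not isolated in `∂X`: every neighbourhood `{ζ : (ξ|ζ)_p > R}` of `ξ` contains a point
other than `ξ`. -/
def IsNonIsolated (ξ : Boundary X) : Prop :=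
  ∀ (p : X) (R : ℝ), ∃ ζ : Boundary X, ζ ≠ ξ ∧ (R : EReal) < boundaryProd p ξ ζ

end Space

section Metrics

variable {Y Z : Type u}

/-- `f` is an `L`-bilipschitz map from `(Y, dY)` to `(Z, dZ)`. -/
def IsBilipschitz (dY : MetricSpace Y) (dZ : MetricSpace Z) (L : ℝ) (f : Y → Z) : Prop :=
  ∀ x y : Y, L⁻¹ * dY.dist x y ≤ dZ.dist (f x) (f y) ∧ dZ.dist (f x) (f y) ≤ L * dY.dist x y

/-- The metric space `(Y, d)` is unbounded. -/
def IsUnbounded (d : MetricSpace Y) : Prop :=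
  ∀ R : ℝ, ∃ x y : Y, R < d.dist x y

/-- `d'` is a metric inversion of `(Y, d)` at `p`. -/
def IsMetricInversion (d : MetricSpace Y) (p : Y) (d' : MetricSpace {x : Y // x ≠ p}) : Prop :=
  ∀ x y : {x : Y // x ≠ p},
    d.dist x.1 y.1 / (4 * d.dist x.1 p * d.dist y.1 p) ≤ d'.dist x y ∧
      d'.dist x y ≤ d.dist x.1 y.1 / (d.dist x.1 p * d.dist y.1 p)

/-- The function `s_p` on `S_p(Y) = Y ∪ {∞}`. -/
def sphereFun (d : MetricSpace Y) (p : Y) : OnePoint Y → OnePoint Y → ℝ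
  | OnePoint.some x, OnePoint.some y => d.dist x y / ((1 + d.dist x p) * (1 + d.dist y p))
  | OnePoint.some x, OnePoint.infty => 1 / (1 + d.dist x p)
  | OnePoint.infty, OnePoint.some y => 1 / (1 + d.dist y p)
  | OnePoint.infty, OnePoint.infty => 0

/-- `d'` is a sphericalization of `(Y, d)` at `p`: a metric on `Y ∪ {∞}` with
`s_p / 4 ≤ d' ≤ s_p`. -/
def IsSphericalization (d : MetricSpace Y) (p : Y) (d' : MetricSpace (OnePoint Y)) : Prop :=
  ∀ x y : OnePoint Y, 1 / 4 * sphereFun d p x y ≤ d'.dist x y ∧ d'.dist x y ≤ sphereFun d p x y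

open Classical in
/-- The bijection `Y → (Y ∖ {ξ}) ∪ {∞}` that is the identity on `Y ∖ {ξ}` and maps `ξ` to `∞`. -/
def toSphere (ξ : Y) (ζ : Y) : OnePoint {η : Y // η ≠ ξ} :=
  if h : ζ = ξ then OnePoint.infty else OnePoint.some ⟨ζ, h⟩

theorem toSphere_bijective (ξ : Y) : Function.Bijective (toSphere ξ) := by
  classical
  have h : toSphere ξ = (Equiv.optionSubtypeNe ξ).symm := by
    funext ζ
    by_cases hζ : ζ = ξ
    · subst hζ
      simp [toSphere]
      rfl
    · simp [toSphere, hζ, Equiv.optionSubtypeNe_symm_of_ne hζ]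
      rfl
  rw [h]
  exact (Equiv.optionSubtypeNe ξ).symm.bijective

end Metrics

end ParabolicVisual

end

open ParabolicVisual

/-! Everything rests on one estimate, `IsHyperbolic.abs_toReal_height_sub_le`: up to a bounded
error, H(η₁,η₂) is (η₁|η₂)_p - (ξ|η₁)_p - (ξ|η₂)_p. To see it, take z = γ(n) far along a ray from p
to ξ. The distance from z to a geodesic with ends a, b is (a|b)_z up to 2δ, and (a|b)_z - d(p,z) =
(a|b)_p - (z|a)_p - (z|b)_p exactly. For large n the left side measures the lowest Busemann value on
the geodesic, and the right side approaches the boundary products up to multiples of δ.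

Exponentiating, e^{-εH} is d(η₁,η₂)/(d(η₁,ξ)d(η₂,ξ)) up to a factor controlled by δ and ε₀. So a
parabolic visual metric is coarsely the inversion of a visual metric
(`IsParabolicVisualMetric.isCoarseInversion`), which gives the first claim. Moreover 1 + dpar(x,η)
is comparable to 1/d(x,ξ), so sphericalizing at η cancels the inversion; here the constant also
involves d(η,ξ).

All metrics are built as infima over chains. Boundary products and heights are ultrametric up to an
additive error, so Frink's argument applies for small ε (`exists_metricSpace_exp`). Inversions and
sphericalizations are both of the form ρ(x,y)r(x)r(y) and come from `exists_metricSpace_of_weight`.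
-/

noncomputable section

namespace ParabolicVisual

universe u

/-! ### Gromov products and four-point inequalities in X. -/

section Hyperbolic

variable {X : Type u} [MetricSpace X] {δ : ℝ}

theorem gromovProd_nonneg (w x y : X) : 0 ≤ gromovProd w x y := by
  unfold gromovProd
  linarith [dist_triangle_left x y w]

theorem gromovProd_le_left (w x y : X) : gromovProd w x y ≤ dist w x := by
  unfold gromovProd
  linarith [dist_triangle w x y]

theorem gromovProd_le_right (w x y : X) : gromovProd w x y ≤ dist w y := by
  rw [gromovProd_comm]
  exact gromovProd_le_left w y x

theorem gromovProd_sub_dist_le (w w' x y : X) :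
    gromovProd w x y - dist w w' ≤ gromovProd w' x y := by
  unfold gromovProd
  linarith [dist_triangle w w' x, dist_triangle w w' y]

theorem gromovProd_sub_dist_le_left (w x x' y : X) :
    gromovProd w x y - dist x x' ≤ gromovProd w x' y := by
  unfold gromovProd
  linarith [dist_triangle w x' x, dist_triangle x' x y, dist_comm x x']

/-- Once the products are expanded, hyperbolicity compares the three ways of pairing four points,
and no base point is distinguished any more. This is what permits a four-point inequality between
products based at an unrelated point p. -/
theorem IsHyperbolic.dist_add_dist_le (h : IsHyperbolic X δ) (w x y z : X) :
    dist x z + dist w y ≤ max (dist x y + dist w z) (dist y z + dist w x) + 2 * δ := by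
  have := h w x y z
  unfold gromovProd at this
  rcases min_cases ((dist w x + dist w y - dist x y) / 2) ((dist w y + dist w z - dist y z) / 2)
    with ⟨h1, _⟩ | ⟨h1, _⟩
  · rw [h1] at this
    linarith [le_max_left (dist x y + dist w z) (dist y z + dist w x)]
  · rw [h1] at this
    linarith [le_max_right (dist x y + dist w z) (dist y z + dist w x)]

/-- The symmetric four point inequality for Gromov products. -/
theorem IsHyperbolic.gromovProd_add_le (h : IsHyperbolic X δ) (p w x y z : X) :
    min (gromovProd p x y + gromovProd p w z) (gromovProd p y z + gromovProd p w x) - δ ≤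
      gromovProd p x z + gromovProd p w y := by
  have := h.dist_add_dist_le w x y z
  unfold gromovProd
  rcases max_cases (dist x y + dist w z) (dist y z + dist w x) with ⟨h1, _⟩ | ⟨h1, _⟩
  · rw [h1] at this
    refine (sub_le_sub_right (min_le_left _ _) _).trans ?_
    linarith
  · rw [h1] at this
    refine (sub_le_sub_right (min_le_right _ _) _).trans ?_
    linarith

theorem IsHyperbolic.min_min_le (h : IsHyperbolic X δ) (p x x' y' y : X) {r : ℝ}
    (h1 : r ≤ gromovProd p x x') (h2 : r ≤ gromovProd p x' y') (h3 : r ≤ gromovProd p y' y)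
    (hδ : 0 ≤ δ) : r - 2 * δ ≤ gromovProd p x y := by
  have e1 := h p x x' y'
  have e2 := h p x y' y
  have e3 : r - δ ≤ gromovProd p x y' := by linarith [le_min h1 h2]
  have e4 : r - δ ≤ gromovProd p y' y := by linarith
  linarith [le_min e3 e4]

/-! ### Sequences at infinity and Gromov products on the boundary. -/

theorem asymptotic_of_basepoint (p : X) {x y : ℕ → X}
    (h : Tendsto (fun n : ℕ × ℕ => gromovProd p (x n.1) (y n.2)) atTop atTop) :
    Asymptotic x y := by
  intro w
  refine tendsto_atTop_mono (fun n => gromovProd_sub_dist_le p w _ _) ?_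
  simpa only [sub_eq_add_neg] using tendsto_atTop_add_const_right _ (-dist p w) h

theorem Asymptotic.eventually_le {x y : ℕ → X} (h : Asymptotic x y) (p : X) (r : ℝ) :
    ∃ N, ∀ i ≥ N, ∀ j ≥ N, r ≤ gromovProd p (x i) (y j) := by
  obtain ⟨a, ha⟩ := eventually_atTop.1 (tendsto_atTop.1 (h p) r)
  exact ⟨max a.1 a.2, fun i hi j hj => ha (i, j) ⟨(le_max_left _ _).trans hi,
    (le_max_right _ _).trans hj⟩⟩

theorem asymptotic_of_forall (p : X) {x y : ℕ → X}
    (h : ∀ r : ℝ, ∃ N, ∀ i ≥ N, ∀ j ≥ N, r ≤ gromovProd p (x i) (y j)) : Asymptotic x y := by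
  refine asymptotic_of_basepoint p (tendsto_atTop.2 fun r => ?_)
  obtain ⟨N, hN⟩ := h r
  exact eventually_atTop.2 ⟨(N, N), fun n hn => hN _ hn.1 _ hn.2⟩

theorem eventually_prod_atTop {P : ℕ × ℕ → Prop} :
    (∀ᶠ n in atTop, P n) ↔ ∃ N, ∀ i ≥ N, ∀ j ≥ N, P (i, j) := by
  rw [eventually_atTop]
  constructor
  · rintro ⟨a, ha⟩
    exact ⟨max a.1 a.2, fun i hi j hj => ha (i, j) ⟨(le_max_left _ _).trans hi,
      (le_max_right _ _).trans hj⟩⟩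
  · rintro ⟨N, hN⟩
    exact ⟨(N, N), fun n hn => hN _ hn.1 _ hn.2⟩

theorem exists_convergesTo (ξ : Boundary X) : ∃ x, ConvergesTo x ξ := by
  obtain ⟨x, rfl⟩ := Quot.exists_rep ξ
  exact ⟨x.1, x.2, rfl⟩

theorem ConvergesTo.eq_of_asymptotic {x y : ℕ → X} {ξ η : Boundary X} (hx : ConvergesTo x ξ)
    (hy : ConvergesTo y η) (h : Asymptotic x y) : ξ = η := by
  obtain ⟨_, rfl⟩ := hx
  obtain ⟨_, rfl⟩ := hy
  exact Quot.sound h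

/-- Equality in `Quot` only yields the generated equivalence relation; hyperbolicity makes the
relation transitive, hence equal to the generated one. -/
theorem ConvergesTo.asymptotic (h : IsHyperbolic X δ) {x y : ℕ → X} {ξ : Boundary X}
    (hx : ConvergesTo x ξ) (hy : ConvergesTo y ξ) : Asymptotic x y := by
  obtain ⟨hx', rfl⟩ := hx
  obtain ⟨hy', e⟩ := hy
  have := (Equivalence.eqvGen_iff h.equivalence).1 (Quot.eqvGen_exact e)
  exact this.symm

theorem ConvergesTo.of_asymptotic (h : IsHyperbolic X δ) {x y : ℕ → X} {ξ : Boundary X}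
    (hx : ConvergesTo x ξ) (hxy : Asymptotic y x) : ConvergesTo y ξ := by
  obtain ⟨hx', rfl⟩ := hx
  exact ⟨h.asymptotic_trans hxy hxy.symm, Quot.sound hxy⟩

theorem ConvergesTo.tendsto_dist {x : ℕ → X} {ξ : Boundary X} (hx : ConvergesTo x ξ) (p : X)
    (r : ℝ) : ∀ᶠ n in atTop, r ≤ dist p (x n) := by
  obtain ⟨N, hN⟩ := hx.1.eventually_le p r
  exact eventually_atTop.2 ⟨N, fun n hn => (hN n hn n hn).trans (gromovProd_le_left _ _ _)⟩

theorem boundaryProd_comm (p : X) (ξ η : Boundary X) :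
    boundaryProd p ξ η = boundaryProd p η ξ := by
  have key : ∀ ξ η : Boundary X, boundaryProd p ξ η ≤ boundaryProd p η ξ := by
    intro ξ η
    refine iSup_le fun x => iSup_le fun y => iSup_le fun hx => iSup_le fun hy => ?_
    have e : liminf (fun n : ℕ × ℕ => (gromovProd p (x n.1) (y n.2) : EReal)) atTop
        = liminf (fun n : ℕ × ℕ => (gromovProd p (y n.1) (x n.2) : EReal)) atTop := by
      have hs : map (Prod.swap : ℕ × ℕ → ℕ × ℕ) atTop = atTop := by
        rw [← prod_atTop_atTop_eq]
        exact (prod_comm (f := (atTop : Filter ℕ)) (g := atTop)).symm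
      conv_rhs => rw [← hs]
      rw [liminf, liminf, Filter.map_map]
      congr 2
      funext n
      simp [gromovProd_comm p (x n.1)]
    rw [e]
    exact le_iSup_of_le y (le_iSup_of_le x (le_iSup_of_le hy (le_iSup_of_le hx le_rfl)))
  exact le_antisymm (key _ _) (key _ _)

theorem boundaryProd_nonneg (p : X) (ξ η : Boundary X) : 0 ≤ boundaryProd p ξ η := by
  obtain ⟨x, hx⟩ := exists_convergesTo ξ
  obtain ⟨y, hy⟩ := exists_convergesTo η
  refine le_iSup_of_le x (le_iSup_of_le y (le_iSup_of_le hx (le_iSup_of_le hy ?_)))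
  refine le_liminf_of_le (by isBoundedDefault) (Eventually.of_forall fun n => ?_)
  exact_mod_cast gromovProd_nonneg _ _ _

theorem le_boundaryProd {p : X} {x y : ℕ → X} {ξ η : Boundary X} (hx : ConvergesTo x ξ)
    (hy : ConvergesTo y η) {r : ℝ} {N : ℕ}
    (h : ∀ i ≥ N, ∀ j ≥ N, r ≤ gromovProd p (x i) (y j)) : (r : EReal) ≤ boundaryProd p ξ η := by
  refine le_iSup_of_le x (le_iSup_of_le y (le_iSup_of_le hx (le_iSup_of_le hy ?_)))
  refine le_liminf_of_le (by isBoundedDefault) (eventually_prod_atTop.2 ⟨N, fun i hi j hj => ?_⟩)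
  exact_mod_cast h i hi j hj

theorem boundaryProd_self (p : X) (ξ : Boundary X) : boundaryProd p ξ ξ = ⊤ := by
  obtain ⟨x, hx⟩ := exists_convergesTo ξ
  refine EReal.eq_top_iff_forall_lt _ |>.2 fun r => ?_
  obtain ⟨N, hN⟩ := hx.1.eventually_le p (r + 1)
  refine lt_of_lt_of_le ?_ (le_boundaryProd hx hx hN)
  exact_mod_cast lt_add_one r

/-- Some pair x', y' has liminf above r. Passing from x to x' to y' to y costs 2δ, because the two
outer products tend to infinity. -/
theorem IsHyperbolic.eventually_le_gromovProd (h : IsHyperbolic X δ) (hδ : 0 ≤ δ) {p : X}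
    {x y : ℕ → X} {ξ η : Boundary X} (hx : ConvergesTo x ξ) (hy : ConvergesTo y η) {r : ℝ}
    (hr : (r : EReal) < boundaryProd p ξ η) :
    ∃ N, ∀ i ≥ N, ∀ j ≥ N, r - 2 * δ ≤ gromovProd p (x i) (y j) := by
  simp only [boundaryProd, lt_iSup_iff] at hr
  obtain ⟨x', y', hx', hy', hr⟩ := hr
  obtain ⟨N, hN⟩ := eventually_prod_atTop.1 (eventually_lt_of_lt_liminf hr)
  obtain ⟨N₁, hN₁⟩ := (hx.asymptotic h hx').eventually_le p r
  obtain ⟨N₂, hN₂⟩ := (hy'.asymptotic h hy).eventually_le p r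
  refine ⟨max N₁ N₂, fun i hi j hj => ?_⟩
  obtain ⟨hi1, hi2⟩ := max_le_iff.1 hi
  obtain ⟨hj1, hj2⟩ := max_le_iff.1 hj
  set k := max N (max N₁ N₂)
  have hk : N ≤ k := le_max_left _ _
  have hk1 : N₁ ≤ k := (le_max_left _ _).trans (le_max_right _ _)
  have hk2 : N₂ ≤ k := (le_max_right _ _).trans (le_max_right _ _)
  refine h.min_min_le p (x i) (x' k) (y' k) (y j) (hN₁ i hi1 k hk1) ?_ (hN₂ k hk2 j hj2) hδ
  exact (EReal.coe_lt_coe_iff.1 (hN k hk k hk)).le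

/-- A single pair far out with product above r + 2δ would force all products far out to be at least
r, and hence the boundary product as well. -/
theorem IsHyperbolic.eventually_gromovProd_le (h : IsHyperbolic X δ) (hδ : 0 ≤ δ) {p : X}
    {x y : ℕ → X} {ξ η : Boundary X} (hx : ConvergesTo x ξ) (hy : ConvergesTo y η) {r : ℝ}
    (hr : boundaryProd p ξ η < r) :
    ∃ N, ∀ i ≥ N, ∀ j ≥ N, gromovProd p (x i) (y j) ≤ r + 2 * δ := by
  by_contra! hcon
  obtain ⟨N₁, hN₁⟩ := hx.1.eventually_le p (r + 2 * δ)
  obtain ⟨N₂, hN₂⟩ := hy.1.eventually_le p (r + 2 * δ)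
  refine hr.not_ge (le_boundaryProd hx hy (N := max N₁ N₂) fun i hi j hj => ?_)
  obtain ⟨hi1, hi2⟩ := max_le_iff.1 hi
  obtain ⟨hj1, hj2⟩ := max_le_iff.1 hj
  obtain ⟨k, hk, l, hl, hkl⟩ := hcon (max N₁ N₂)
  obtain ⟨hk1, hk2⟩ := max_le_iff.1 hk
  obtain ⟨hl1, hl2⟩ := max_le_iff.1 hl
  have := h.min_min_le p (x i) (x k) (y l) (y j) (hN₁ i hi1 k hk1) hkl.le (hN₂ l hl2 j hj2) hδ
  linarith

theorem IsHyperbolic.boundaryProd_ne_top (h : IsHyperbolic X δ) (hδ : 0 ≤ δ) (p : X)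
    {ξ η : Boundary X} (hne : ξ ≠ η) : boundaryProd p ξ η ≠ ⊤ := by
  intro htop
  obtain ⟨x, hx⟩ := exists_convergesTo ξ
  obtain ⟨y, hy⟩ := exists_convergesTo η
  refine hne (hx.eq_of_asymptotic hy (asymptotic_of_forall p fun r => ?_))
  obtain ⟨N, hN⟩ := h.eventually_le_gromovProd hδ hx hy (p := p) (r := r + 2 * δ)
    (by rw [htop]; exact EReal.coe_lt_top _)
  exact ⟨N, fun i hi j hj => by linarith [hN i hi j hj]⟩

theorem IsHyperbolic.coe_toReal_boundaryProd (h : IsHyperbolic X δ) (hδ : 0 ≤ δ) (p : X)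
    {ξ η : Boundary X} (hne : ξ ≠ η) :
    ((boundaryProd p ξ η).toReal : EReal) = boundaryProd p ξ η :=
  EReal.coe_toReal (h.boundaryProd_ne_top hδ p hne)
    (ne_bot_of_le_ne_bot (by simp) (boundaryProd_nonneg p ξ η))

/-- The Gromov product of distinct boundary points is approximated by the Gromov products of the
points of any two sequences converging to them. -/
theorem IsHyperbolic.eventually_gromovProd_approx (h : IsHyperbolic X δ) (hδ : 0 ≤ δ) (p : X)
    {x y : ℕ → X} {ξ η : Boundary X} (hx : ConvergesTo x ξ) (hy : ConvergesTo y η) (hne : ξ ≠ η) :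
    ∀ᶠ n : ℕ in atTop, ∀ i ≥ n, ∀ j ≥ n,
      (boundaryProd p ξ η).toReal - (2 * δ + 1) ≤ gromovProd p (x i) (y j) ∧
      gromovProd p (x i) (y j) ≤ (boundaryProd p ξ η).toReal + (2 * δ + 1) := by
  have e := h.coe_toReal_boundaryProd hδ p hne
  obtain ⟨N₁, hN₁⟩ := h.eventually_le_gromovProd hδ hx hy (p := p)
    (r := (boundaryProd p ξ η).toReal - 1) (by rw [← e]; exact_mod_cast sub_one_lt _)
  obtain ⟨N₂, hN₂⟩ := h.eventually_gromovProd_le hδ hx hy (p := p)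
    (r := (boundaryProd p ξ η).toReal + 1) (by
      conv_lhs => rw [← e]
      exact_mod_cast lt_add_one _)
  refine eventually_atTop.2 ⟨max N₁ N₂, fun n hn i hi j hj => ?_⟩
  obtain ⟨hn1, hn2⟩ := max_le_iff.1 hn
  constructor
  · linarith [hN₁ i (hn1.trans hi) j (hn1.trans hj)]
  · linarith [hN₂ i (hn2.trans hi) j (hn2.trans hj)]

/-- The boundary version of the inequality defining hyperbolicity. -/
theorem IsHyperbolic.min_toReal_boundaryProd_le (h : IsHyperbolic X δ) (hδ : 0 ≤ δ) (p : X)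
    {ξ η ζ : Boundary X} (h1 : ξ ≠ η) (h2 : η ≠ ζ) (h3 : ξ ≠ ζ) :
    min (boundaryProd p ξ η).toReal (boundaryProd p η ζ).toReal - (5 * δ + 2) ≤
      (boundaryProd p ξ ζ).toReal := by
  obtain ⟨x, hx⟩ := exists_convergesTo ξ
  obtain ⟨y, hy⟩ := exists_convergesTo η
  obtain ⟨z, hz⟩ := exists_convergesTo ζ
  obtain ⟨n, a, b, c⟩ := ((h.eventually_gromovProd_approx hδ p hx hy h1).and
    ((h.eventually_gromovProd_approx hδ p hy hz h2).and
      (h.eventually_gromovProd_approx hδ p hx hz h3))).exists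
  have a := a n le_rfl n le_rfl
  have b := b n le_rfl n le_rfl
  have c := c n le_rfl n le_rfl
  have e := h p (x n) (y n) (z n)
  have : min (boundaryProd p ξ η).toReal (boundaryProd p η ζ).toReal - (2 * δ + 1) ≤
      min (gromovProd p (x n) (y n)) (gromovProd p (y n) (z n)) :=
    le_min (by linarith [min_le_left (boundaryProd p ξ η).toReal (boundaryProd p η ζ).toReal])
      (by linarith [min_le_right (boundaryProd p ξ η).toReal (boundaryProd p η ζ).toReal])
  linarith

/-- The boundary version of the symmetric four point inequality. -/
theorem IsHyperbolic.toReal_boundaryProd_add_le (h : IsHyperbolic X δ) (hδ : 0 ≤ δ) (p : X)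
    {ω ξ η ζ : Boundary X} (h1 : ξ ≠ η) (h2 : η ≠ ζ) (h3 : ξ ≠ ζ) (h4 : ω ≠ ξ) (h5 : ω ≠ η)
    (h6 : ω ≠ ζ) :
    min ((boundaryProd p ξ η).toReal + (boundaryProd p ω ζ).toReal)
        ((boundaryProd p η ζ).toReal + (boundaryProd p ω ξ).toReal) - (9 * δ + 4) ≤
      (boundaryProd p ξ ζ).toReal + (boundaryProd p ω η).toReal := by
  obtain ⟨w, hw⟩ := exists_convergesTo ω
  obtain ⟨x, hx⟩ := exists_convergesTo ξ
  obtain ⟨y, hy⟩ := exists_convergesTo η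
  obtain ⟨z, hz⟩ := exists_convergesTo ζ
  obtain ⟨n, a, b, c, d, e, f⟩ := ((h.eventually_gromovProd_approx hδ p hx hy h1).and
    ((h.eventually_gromovProd_approx hδ p hy hz h2).and
    ((h.eventually_gromovProd_approx hδ p hx hz h3).and
    ((h.eventually_gromovProd_approx hδ p hw hx h4).and
    ((h.eventually_gromovProd_approx hδ p hw hy h5).and
      (h.eventually_gromovProd_approx hδ p hw hz h6)))))).exists
  have a := a n le_rfl n le_rfl
  have b := b n le_rfl n le_rfl
  have c := c n le_rfl n le_rfl
  have d := d n le_rfl n le_rfl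
  have e := e n le_rfl n le_rfl
  have f := f n le_rfl n le_rfl
  have g := h.gromovProd_add_le p (w n) (x n) (y n) (z n)
  set A := (boundaryProd p ξ η).toReal + (boundaryProd p ω ζ).toReal
  set B := (boundaryProd p η ζ).toReal + (boundaryProd p ω ξ).toReal
  have : min A B - 2 * (2 * δ + 1) ≤
      min (gromovProd p (x n) (y n) + gromovProd p (w n) (z n))
        (gromovProd p (y n) (z n) + gromovProd p (w n) (x n)) :=
    le_min (by linarith [min_le_left A B]) (by linarith [min_le_right A B])
  linarith

/-! ### Geodesic rays and complete geodesics as limits of segments. -/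

/-- On a geodesic from `a` to `b`, the point `x` facing `z` is at distance about `(a|b)_z`
from `z`. -/
theorem IsHyperbolic.dist_le_gromovProd_add (h : IsHyperbolic X δ) {z a b x : X}
    (ha : dist x a = dist z a - gromovProd z a b) (hb : dist x b = dist z b - gromovProd z a b) :
    dist z x ≤ gromovProd z a b + 2 * δ := by
  have := h.dist_add_dist_le z a x b
  rw [dist_comm a x, ha, hb] at this
  -- The position of x makes the two competing pairings equal, so the maximum disappears.
  have e : dist z a - gromovProd z a b + dist z b = dist z b - gromovProd z a b + dist z a := by
    ring
  rw [e, max_self] at this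
  unfold gromovProd at *
  linarith

theorem gromovProd_le_dist_of_between {z a b x : X} (hx : dist a x + dist x b = dist a b) :
    gromovProd z a b ≤ dist z x := by
  unfold gromovProd
  linarith [dist_triangle z x a, dist_triangle z x b, dist_comm x a]

/-- Pointwise limits of longer and longer geodesics, along an ultrafilter. -/
theorem exists_limit_geodesic [ProperSpace X] {S : Set ℝ} (h0 : (0 : ℝ) ∈ S) {σ : ℕ → ℝ → X}
    {p : X} {R : ℝ} (hR : ∀ᶠ n in atTop, dist p (σ n 0) ≤ R)
    (hσ : ∀ s ∈ S, ∀ t ∈ S, ∀ᶠ n in atTop, dist (σ n s) (σ n t) = |s - t|) :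
    ∃ (U : Ultrafilter ℕ) (τ : ℝ → X), (U : Filter ℕ) ≤ atTop ∧
      (∀ t ∈ S, Tendsto (fun n => σ n t) U (𝓝 (τ t))) ∧
      ∀ s ∈ S, ∀ t ∈ S, dist (τ s) (τ t) = |s - t| := by
  -- One ultrafilter gives convergence for all times t at once, since each σ n t eventually stays in
  -- a compact ball; no diagonal subsequence is needed.
  obtain ⟨U, hU⟩ := Ultrafilter.exists_le (atTop : Filter ℕ)
  have key : ∀ t : ℝ, ∃ x : X, t ∈ S → Tendsto (fun n => σ n t) U (𝓝 x) := by
    intro t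
    by_cases ht : t ∈ S
    · have hmem : ∀ᶠ n in atTop, σ n t ∈ Metric.closedBall p (R + |0 - t|) := by
        filter_upwards [hR, hσ 0 h0 t ht] with n h1 h2
        rw [Metric.mem_closedBall, dist_comm]
        linarith [dist_triangle p (σ n 0) (σ n t)]
      obtain ⟨x, _, hx⟩ := (isCompact_closedBall p (R + |0 - t|)).ultrafilter_le_nhds
        (U.map fun n => σ n t) (le_principal_iff.2 (hU hmem))
      exact ⟨x, fun _ => hx⟩
    · exact ⟨p, fun h => absurd h ht⟩
  choose τ hτ using key
  refine ⟨U, τ, hU, hτ, fun s hs t ht => ?_⟩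
  have h1 : Tendsto (fun n => dist (σ n s) (σ n t)) U (𝓝 (dist (τ s) (τ t))) :=
    (hτ s hs).dist (hτ t ht)
  have h2 : Tendsto (fun n => dist (σ n s) (σ n t)) U (𝓝 |s - t|) :=
    tendsto_const_nhds.congr' ((hσ s hs t ht).filter_mono hU |>.mono fun n hn => hn.symm)
  exact tendsto_nhds_unique h1 h2

/-- The limit of geodesics pointing towards `y n` converges to the limit of `y n`. -/
theorem IsHyperbolic.convergesTo_limit (h : IsHyperbolic X δ) {U : Ultrafilter ℕ}
    (hU : (U : Filter ℕ) ≤ atTop) {ρ : ℕ → ℕ → X} {τ y : ℕ → X} {η : Boundary X} {p : X} {R : ℝ}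
    (hτ : ∀ k, Tendsto (fun n => ρ n k) U (𝓝 (τ k))) (hy : ConvergesTo y η)
    (hR : ∀ᶠ n in atTop, dist p (ρ n 0) ≤ R)
    (hk : ∀ k : ℕ, ∀ᶠ n in atTop, dist (ρ n 0) (ρ n k) = k ∧
      dist (ρ n 0) (y n) = k + dist (ρ n k) (y n)) : ConvergesTo τ η := by
  refine hy.of_asymptotic h (asymptotic_of_forall p fun r => ?_)
  obtain ⟨N₁, hN₁⟩ := hy.1.eventually_le p (r + δ)
  -- The product of ρ m k and y m seen from ρ m 0 is k. Moving the base point to p costs R,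
  -- replacing ρ m k by the limit τ k costs 1, and passing from y m to y j costs δ.
  obtain ⟨N₂, hN₂⟩ := exists_nat_ge (r + δ + R + 1)
  refine ⟨max N₁ N₂, fun k hk' j hj => ?_⟩
  obtain ⟨hk1, hk2⟩ := max_le_iff.1 hk'
  obtain ⟨hj1, hj2⟩ := max_le_iff.1 hj
  have hclose : ∀ᶠ n in (U : Filter ℕ), dist (ρ n k) (τ k) < 1 :=
    Metric.tendsto_nhds.1 (hτ k) 1 one_pos
  obtain ⟨m, hm1, hm2, ⟨hm3, hm4⟩, hm5⟩ := (hclose.and ((hR.filter_mono hU).and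
    (((hk k).filter_mono hU).and ((eventually_ge_atTop N₁).filter_mono hU)))).exists
  have e1 : gromovProd (ρ m 0) (ρ m k) (y m) = k := by
    unfold gromovProd
    rw [hm3, hm4]
    ring
  have e2 := gromovProd_sub_dist_le (ρ m 0) p (ρ m k) (y m)
  have e3 := gromovProd_sub_dist_le_left p (ρ m k) (τ k) (y m)
  have e4 : (N₂ : ℝ) ≤ k := by exact_mod_cast hk2
  have e5 : r + δ ≤ gromovProd p (τ k) (y m) := by
    rw [dist_comm] at hm2
    linarith
  have e6 := h p (τ k) (y m) (y j)
  linarith [le_min e5 (hN₁ m hm5 j hj1)]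

theorem IsHyperbolic.exists_isRay [ProperSpace X] (h : IsHyperbolic X δ) (hX : IsGeodesicSpace X)
    (p : X) (ξ : Boundary X) : ∃ γ, IsRay γ p ξ := by
  obtain ⟨x, hx⟩ := exists_convergesTo ξ
  choose g hg0 hg1 hg using fun n => hX p (x n)
  have hR : ∀ᶠ n in atTop, dist p (g n 0) ≤ 0 := by
    refine Eventually.of_forall fun n => ?_
    rw [hg0, dist_self]
  obtain ⟨U, τ, hU, hlim, hτ⟩ := exists_limit_geodesic (S := Set.Ici 0) (Set.mem_Ici.2 le_rfl)
    hR (fun s hs t ht => by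
      filter_upwards [hx.tendsto_dist p s, hx.tendsto_dist p t] with n h1 h2
      exact hg n s ⟨hs, h1⟩ t ⟨ht, h2⟩)
  refine ⟨fun t => τ t, ?_, ?_, ?_⟩
  · refine Isometry.of_dist_eq fun s t => ?_
    rw [hτ s s.2 t t.2, NNReal.dist_eq]
  · have : Tendsto (fun n => g n 0) U (𝓝 p) := by simp [hg0]
    exact tendsto_nhds_unique (hlim 0 (Set.mem_Ici.2 le_rfl)) this
  · have hk0 : ∀ k : ℕ, (0 : ℝ) ≤ k := fun k => k.cast_nonneg
    refine h.convergesTo_limit hU (ρ := fun n k => g n k) (fun k => by simpa using hlim k (hk0 k))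
      hx (p := p) (R := 0) (by simpa using hR) fun k => ?_
    filter_upwards [hx.tendsto_dist p k] with n hn
    have e0 : (0 : ℝ) ∈ Set.Icc 0 (dist p (x n)) := ⟨le_rfl, dist_nonneg⟩
    have e1 : dist p (x n) ∈ Set.Icc 0 (dist p (x n)) := ⟨dist_nonneg, le_rfl⟩
    constructor
    · rw [Nat.cast_zero, hg n 0 e0 k ⟨hk0 k, hn⟩, zero_sub, abs_neg, abs_of_nonneg (hk0 k)]
    · rw [Nat.cast_zero, hg0]
      conv_rhs => rw [← hg1 n]
      rw [hg n k ⟨hk0 k, hn⟩ _ e1, abs_sub_comm, abs_of_nonneg (sub_nonneg.2 hn)]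
      ring

theorem IsHyperbolic.exists_isCompleteGeodesic [ProperSpace X] (h : IsHyperbolic X δ)
    (hδ : 0 ≤ δ) (hX : IsGeodesicSpace X) (p : X) {η₁ η₂ : Boundary X} (hne : η₁ ≠ η₂) :
    ∃ σ, IsCompleteGeodesic σ η₁ η₂ := by
  obtain ⟨x, hx⟩ := exists_convergesTo η₁
  obtain ⟨y, hy⟩ := exists_convergesTo η₂
  choose g hg0 hg1 hg using fun n => hX (x n) (y n)
  set B := (boundaryProd p η₁ η₂).toReal + (2 * δ + 1)
  have hB : ∀ᶠ n in atTop, gromovProd p (x n) (y n) ≤ B :=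
    (h.eventually_gromovProd_approx hδ p hx hy hne).mono fun n hn => (hn n le_rfl n le_rfl).2
  -- The segments are reparametrized so that time 0 is the point facing p. That point stays within B
  -- + 2δ of p because η₁ ≠ η₂ bounds the products, so the segments cannot escape to infinity.
  set s : ℕ → ℝ := fun n => dist p (x n) - gromovProd p (x n) (y n) with hs
  have hs' : ∀ n, dist (x n) (y n) - s n = dist p (y n) - gromovProd p (x n) (y n) := fun n => by
    simp only [hs, gromovProd]
    ring
  have hs0 : ∀ n, 0 ≤ s n := fun n => sub_nonneg.2 (gromovProd_le_left _ _ _)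
  have hs1 : ∀ n, s n ≤ dist (x n) (y n) := fun n => by
    linarith [hs' n, gromovProd_le_right p (x n) (y n)]
  have hdom : ∀ t : ℝ, ∀ᶠ n in atTop, s n + t ∈ Set.Icc 0 (dist (x n) (y n)) := by
    intro t
    filter_upwards [hB, hx.tendsto_dist p (B + |t|), hy.tendsto_dist p (B + |t|)] with n h1 h2 h3
    constructor
    · linarith [neg_abs_le t, show s n = dist p (x n) - gromovProd p (x n) (y n) from rfl]
    · linarith [le_abs_self t, hs' n]
  have hR : ∀ᶠ n in atTop, dist p (g n (s n + 0)) ≤ B + 2 * δ := by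
    filter_upwards [hB] with n h1
    have e1 : s n + 0 ∈ Set.Icc 0 (dist (x n) (y n)) := by
      rw [add_zero]
      exact ⟨hs0 n, hs1 n⟩
    refine (h.dist_le_gromovProd_add (a := x n) (b := y n) ?_ ?_).trans (by linarith)
    · conv_lhs => rw [← hg0 n]
      rw [hg n _ e1 0 ⟨le_rfl, dist_nonneg⟩, add_zero, sub_zero, abs_of_nonneg (hs0 n)]
    · conv_lhs => rw [← hg1 n]
      rw [hg n _ e1 _ ⟨dist_nonneg, le_rfl⟩, add_zero, abs_sub_comm,
        abs_of_nonneg (sub_nonneg.2 (hs1 n)), hs' n]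
  obtain ⟨U, τ, hU, hlim, hτ⟩ := exists_limit_geodesic (S := Set.univ)
    (σ := fun n t => g n (s n + t)) (Set.mem_univ 0) hR (fun a _ b _ => by
      filter_upwards [hdom a, hdom b] with n h1 h2
      rw [hg n _ h1 _ h2]
      ring_nf)
  have hk0 : ∀ k : ℕ, (0 : ℝ) ≤ k := fun k => k.cast_nonneg
  refine ⟨τ, Isometry.of_dist_eq fun a b => hτ a trivial b trivial, ?_, ?_⟩
  · refine h.convergesTo_limit hU (ρ := fun n k => g n (s n + -k))
      (fun k => hlim (-k) trivial) hx (p := p) (R := B + 2 * δ) (by simpa using hR) fun k => ?_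
    filter_upwards [hdom 0, hdom (-k)] with n h1 h2
    have e0 : (0 : ℝ) ∈ Set.Icc 0 (dist (x n) (y n)) := ⟨le_rfl, dist_nonneg⟩
    rw [Nat.cast_zero, neg_zero]
    constructor
    · rw [hg n _ h1 _ h2]
      ring_nf
      exact abs_of_nonneg (hk0 k)
    · conv_lhs => rw [← hg0 n]
      conv_rhs => rw [← hg0 n]
      rw [hg n _ h1 _ e0, hg n _ h2 _ e0, sub_zero, sub_zero, abs_of_nonneg h1.1,
        abs_of_nonneg h2.1]
      ring
  · refine h.convergesTo_limit hU (ρ := fun n k => g n (s n + k))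
      (fun k => hlim k trivial) hy (p := p) (R := B + 2 * δ) (by simpa using hR) fun k => ?_
    filter_upwards [hdom 0, hdom k] with n h1 h2
    have e0 : dist (x n) (y n) ∈ Set.Icc 0 (dist (x n) (y n)) := ⟨dist_nonneg, le_rfl⟩
    rw [Nat.cast_zero]
    constructor
    · rw [hg n _ h1 _ h2]
      ring_nf
      rw [abs_neg]
      exact abs_of_nonneg (hk0 k)
    · conv_lhs => rw [← hg1 n]
      conv_rhs => rw [← hg1 n]
      rw [hg n _ h1 _ e0, hg n _ h2 _ e0, abs_sub_comm, abs_of_nonneg (sub_nonneg.2 h1.2),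
        abs_sub_comm, abs_of_nonneg (sub_nonneg.2 h2.2)]
      ring

/-! ### Busemann functions. -/

section Busemann

variable {γ γ' : ℝ≥0 → X} {p : X} {ξ : Boundary X}

theorem IsRay.dist_eq (hγ : IsRay γ p ξ) (t : ℝ≥0) : dist p (γ t) = t := by
  rw [← hγ.2.1, hγ.1.dist_eq, NNReal.dist_eq, NNReal.coe_zero, zero_sub, abs_neg,
    NNReal.abs_eq]

theorem IsRay.antitone (hγ : IsRay γ p ξ) (x : X) :
    Antitone fun t : ℝ≥0 => dist (γ t) x - (t : ℝ) := by
  intro s t hst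
  have h1 : dist (γ t) (γ s) = t - s := by
    rw [hγ.1.dist_eq, NNReal.dist_eq, abs_of_nonneg (sub_nonneg.2 (by exact_mod_cast hst))]
  have := dist_triangle (γ t) (γ s) x
  simp only
  linarith

theorem IsRay.bddBelow (hγ : IsRay γ p ξ) (x : X) :
    BddBelow (Set.range fun t : ℝ≥0 => dist (γ t) x - (t : ℝ)) := by
  refine ⟨-dist p x, ?_⟩
  rintro _ ⟨t, rfl⟩
  have := dist_triangle_right p (γ t) x
  simp only
  linarith [hγ.dist_eq t, dist_comm (γ t) x]

theorem IsRay.tendsto_rayBusemann (hγ : IsRay γ p ξ) (x : X) :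
    Tendsto (fun t : ℝ≥0 => dist (γ t) x - (t : ℝ)) atTop (𝓝 (rayBusemann γ x)) :=
  tendsto_nhds_limUnder ⟨_, tendsto_atTop_ciInf (hγ.antitone x) (hγ.bddBelow x)⟩

theorem IsRay.rayBusemann_le (hγ : IsRay γ p ξ) (x : X) (t : ℝ≥0) :
    rayBusemann γ x ≤ dist (γ t) x - t :=
  (hγ.antitone x).le_of_tendsto (hγ.tendsto_rayBusemann x) t

theorem IsRay.tendsto_nat_rayBusemann (hγ : IsRay γ p ξ) (x : X) :
    Tendsto (fun n : ℕ => dist (γ n) x - (n : ℝ)) atTop (𝓝 (rayBusemann γ x)) :=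
  ((hγ.tendsto_rayBusemann x).comp tendsto_natCast_atTop_atTop).congr fun n => by simp

theorem IsRay.dist_sub_eq (hγ : IsRay γ p ξ) (x : X) (n : ℕ) :
    dist (γ n) x - (n : ℝ) = dist p x - 2 * gromovProd p (γ n) x := by
  have := hγ.dist_eq n
  unfold gromovProd
  rw [this]
  push_cast
  ring

theorem IsHyperbolic.rayBusemann_le_add (h : IsHyperbolic X δ) (hγ : IsRay γ p ξ)
    (hγ' : IsRay γ' p ξ) (x : X) : rayBusemann γ' x ≤ rayBusemann γ x + 2 * δ := by
  -- Once (γ'(n)|γ(n))_p exceeds d(p,x), which bounds (γ(n)|x)_p, the minimum in the hyperbolic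
  -- inequality is (γ(n)|x)_p. The factor 2 in `dist_sub_eq` turns δ into 2δ.
  obtain ⟨N, hN⟩ := (hγ'.2.2.asymptotic h hγ.2.2).eventually_le p (dist p x)
  refine le_of_tendsto_of_tendsto (hγ'.tendsto_nat_rayBusemann x)
    ((hγ.tendsto_nat_rayBusemann x).add_const _) (eventually_atTop.2 ⟨N, fun n hn => ?_⟩)
  simp only
  rw [hγ.dist_sub_eq, hγ'.dist_sub_eq]
  have e1 := h p (γ' n) (γ n) x
  have e2 := (gromovProd_le_right p (γ n) x).trans (hN n hn n hn)
  rw [min_eq_right e2] at e1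
  linarith

theorem IsRay.bddAbove (p x : X) (ξ : Boundary X) :
    BddAbove {b : ℝ | ∃ γ : ℝ≥0 → X, IsRay γ p ξ ∧ b = rayBusemann γ x} := by
  refine ⟨dist p x, ?_⟩
  rintro _ ⟨γ, hγ, rfl⟩
  have := hγ.rayBusemann_le x 0
  rwa [hγ.2.1, NNReal.coe_zero, sub_zero] at this

theorem IsRay.rayBusemann_le_busemann (hγ : IsRay γ p ξ) (x : X) :
    rayBusemann γ x ≤ busemann ξ p x :=
  le_csSup (IsRay.bddAbove p x ξ) ⟨γ, hγ, rfl⟩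

theorem IsHyperbolic.busemann_le (h : IsHyperbolic X δ) (hγ : IsRay γ p ξ) (x : X) :
    busemann ξ p x ≤ rayBusemann γ x + 2 * δ := by
  refine csSup_le ⟨_, γ, hγ, rfl⟩ ?_
  rintro _ ⟨γ', hγ', rfl⟩
  exact h.rayBusemann_le_add hγ hγ' x

end Busemann

/-! ### Heights in terms of boundary products. -/

/-- With z = γ(n) on a ray from p to ξ, this converts the height of the geodesic from a to b, as
seen from z, into products based at p. -/
theorem gromovProd_sub_dist_eq (z a b p : X) : gromovProd z a b - dist p z =
    gromovProd p a b - gromovProd p z a - gromovProd p z b := by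
  unfold gromovProd
  ring

theorem IsCompleteGeodesic.reverse {σ : ℝ → X} {η₁ η₂ : Boundary X}
    (hσ : IsCompleteGeodesic σ η₁ η₂) : IsCompleteGeodesic (fun t => σ (-t)) η₂ η₁ := by
  refine ⟨Isometry.of_dist_eq fun s t => ?_, by simpa using hσ.2.2, hσ.2.1⟩
  rw [hσ.1.dist_eq, dist_neg_neg]

theorem height_comm (ξ : Boundary X) (p : X) (η₁ η₂ : Boundary X) :
    height ξ p η₁ η₂ = height ξ p η₂ η₁ := by
  have key : ∀ η₁ η₂ : Boundary X, height ξ p η₁ η₂ ≤ height ξ p η₂ η₁ := by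
    intro η₁ η₂
    refine le_iInf fun σ => le_iInf fun hσ => le_iInf fun t => ?_
    refine iInf_le_of_le _ (iInf_le_of_le hσ.reverse (iInf_le_of_le (-t) ?_))
    rw [neg_neg]
  exact le_antisymm (key _ _) (key _ _)

/-- For n ≥ |t| the point σ(t) lies between σ(-n) and σ(n), so its distance to γ(n) is at least
(σ(-n)|σ(n))_{γ(n)}. Three approximations with error 2δ + 1 each add up to 6δ + 3. -/
theorem IsHyperbolic.le_height [ProperSpace X] (h : IsHyperbolic X δ) (hδ : 0 ≤ δ)
    (hX : IsGeodesicSpace X) {ξ : Boundary X} (p : X) {η₁ η₂ : Boundary X} (h1 : ξ ≠ η₁)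
    (h2 : ξ ≠ η₂) (h3 : η₁ ≠ η₂) :
    (((boundaryProd p η₁ η₂).toReal - (boundaryProd p ξ η₁).toReal
      - (boundaryProd p ξ η₂).toReal - (6 * δ + 3) : ℝ) : EReal) ≤ height ξ p η₁ η₂ := by
  obtain ⟨γ, hγ⟩ := h.exists_isRay hX p ξ
  refine le_iInf fun σ => le_iInf fun hσ => le_iInf fun t => EReal.coe_le_coe_iff.2 ?_
  refine le_trans (ge_of_tendsto (hγ.tendsto_nat_rayBusemann (σ t)) ?_)
    (hγ.rayBusemann_le_busemann _)
  obtain ⟨M, hM⟩ := exists_nat_ge |t|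
  filter_upwards [h.eventually_gromovProd_approx hδ p hσ.2.1 hσ.2.2 h3,
    h.eventually_gromovProd_approx hδ p hγ.2.2 hσ.2.1 h1,
    h.eventually_gromovProd_approx hδ p hγ.2.2 hσ.2.2 h2, eventually_ge_atTop M]
    with n a b c hn
  have a := (a n le_rfl n le_rfl).1
  have b := (b n le_rfl n le_rfl).2
  have c := (c n le_rfl n le_rfl).2
  have hn' : |t| ≤ n := hM.trans (by exact_mod_cast hn)
  obtain ⟨t1, t2⟩ := abs_le.1 hn'
  have e1 : gromovProd (γ n) (σ (-n)) (σ n) ≤ dist (γ n) (σ t) := by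
    refine gromovProd_le_dist_of_between ?_
    simp only [hσ.1.dist_eq, Real.dist_eq]
    rw [abs_of_nonpos (by linarith), abs_of_nonpos (by linarith), abs_of_nonpos (by linarith)]
    ring
  have e2 := gromovProd_sub_dist_eq (γ n) (σ (-n)) (σ n) p
  have e3 := hγ.dist_eq n
  rw [NNReal.coe_natCast] at e3
  linarith

theorem IsHyperbolic.height_le [ProperSpace X] (h : IsHyperbolic X δ) (hδ : 0 ≤ δ)
    (hX : IsGeodesicSpace X) {ξ : Boundary X} (p : X) {η₁ η₂ : Boundary X} (h1 : ξ ≠ η₁)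
    (h2 : ξ ≠ η₂) (h3 : η₁ ≠ η₂) :
    height ξ p η₁ η₂ ≤ (((boundaryProd p η₁ η₂).toReal - (boundaryProd p ξ η₁).toReal
      - (boundaryProd p ξ η₂).toReal + (10 * δ + 3) : ℝ) : EReal) := by
  obtain ⟨γ, hγ⟩ := h.exists_isRay hX p ξ
  obtain ⟨σ, hσ⟩ := h.exists_isCompleteGeodesic hδ hX p h3
  obtain ⟨n, a, b, c⟩ := ((h.eventually_gromovProd_approx hδ p hσ.2.1 hσ.2.2 h3).and
    ((h.eventually_gromovProd_approx hδ p hγ.2.2 hσ.2.1 h1).and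
    (h.eventually_gromovProd_approx hδ p hγ.2.2 hσ.2.2 h2))).exists
  have a := (a n le_rfl n le_rfl).2
  have b := (b n le_rfl n le_rfl).1
  have c := (c n le_rfl n le_rfl).1
  set s := dist (γ n) (σ (-n)) - gromovProd (γ n) (σ (-n)) (σ n) with hs
  -- The witness is the point of σ facing γ(n); s is measured from σ(-n), hence the parameter s - n.
  -- To the error 6δ + 3 this adds 2δ for the facing point and 2δ for the supremum over rays.
  refine iInf_le_of_le σ (iInf_le_of_le hσ (iInf_le_of_le (s - n) (EReal.coe_le_coe_iff.2 ?_)))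
  have hn : (0 : ℝ) ≤ n := n.cast_nonneg
  have e0 : dist (σ (-n)) (σ n) = 2 * n := by
    rw [hσ.1.dist_eq, Real.dist_eq, abs_of_nonpos (by linarith)]
    ring
  have hs0 : 0 ≤ s := sub_nonneg.2 (gromovProd_le_left _ _ _)
  have hs1 : 2 * n - s = dist (γ n) (σ n) - gromovProd (γ n) (σ (-n)) (σ n) := by
    rw [hs, ← e0]
    unfold gromovProd
    ring
  have hs2 : s ≤ 2 * n := by
    linarith [gromovProd_le_right (γ n) (σ (-n)) (σ n)]
  have e1 : dist (γ n) (σ (s - n)) ≤ gromovProd (γ n) (σ (-n)) (σ n) + 2 * δ := by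
    refine h.dist_le_gromovProd_add ?_ ?_
    · rw [hσ.1.dist_eq, Real.dist_eq, ← hs]
      ring_nf
      exact abs_of_nonneg hs0
    · rw [hσ.1.dist_eq, Real.dist_eq, ← hs1, abs_of_nonpos (by linarith)]
      ring
  have e2 := gromovProd_sub_dist_eq (γ n) (σ (-n)) (σ n) p
  have e3 := hγ.dist_eq n
  have e4 := h.busemann_le hγ (σ (s - n))
  have e5 := hγ.rayBusemann_le (σ (s - n)) n
  rw [NNReal.coe_natCast] at e3 e5
  linarith

theorem IsHyperbolic.coe_toReal_height [ProperSpace X] (h : IsHyperbolic X δ) (hδ : 0 ≤ δ)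
    (hX : IsGeodesicSpace X) {ξ : Boundary X} (p : X) {η₁ η₂ : Boundary X} (h1 : ξ ≠ η₁)
    (h2 : ξ ≠ η₂) (h3 : η₁ ≠ η₂) : ((height ξ p η₁ η₂).toReal : EReal) = height ξ p η₁ η₂ :=
  EReal.coe_toReal (ne_top_of_le_ne_top (EReal.coe_ne_top _) (h.height_le hδ hX p h1 h2 h3))
    (ne_bot_of_le_ne_bot (EReal.coe_ne_bot _) (h.le_height hδ hX p h1 h2 h3))

/-- The height of `η₁, η₂` seen from `ξ` is `(η₁|η₂)_p - (ξ|η₁)_p - (ξ|η₂)_p` up to a bounded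
error. -/
theorem IsHyperbolic.abs_toReal_height_sub_le [ProperSpace X] (h : IsHyperbolic X δ) (hδ : 0 ≤ δ)
    (hX : IsGeodesicSpace X) {ξ : Boundary X} (p : X) {η₁ η₂ : Boundary X} (h1 : ξ ≠ η₁)
    (h2 : ξ ≠ η₂) (h3 : η₁ ≠ η₂) :
    |(height ξ p η₁ η₂).toReal - ((boundaryProd p η₁ η₂).toReal - (boundaryProd p ξ η₁).toReal
      - (boundaryProd p ξ η₂).toReal)| ≤ 10 * δ + 3 := by
  have e1 := h.height_le hδ hX p h1 h2 h3
  have e2 := h.le_height hδ hX p h1 h2 h3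
  rw [← h.coe_toReal_height hδ hX p h1 h2 h3, EReal.coe_le_coe_iff] at e1 e2
  rw [abs_le]
  constructor <;> linarith

/-- Adding the products with ω to both sides turns this into the symmetric four-point inequality on
the boundary. Its error 9δ + 4 is increased by 10δ + 3 for each of the two heights that are
replaced. -/
theorem IsHyperbolic.min_toReal_height_le [ProperSpace X] (h : IsHyperbolic X δ) (hδ : 0 ≤ δ)
    (hX : IsGeodesicSpace X) {ω : Boundary X} (p : X) {ξ η ζ : Boundary X} (h1 : ξ ≠ η)
    (h2 : η ≠ ζ) (h3 : ξ ≠ ζ) (h4 : ω ≠ ξ) (h5 : ω ≠ η) (h6 : ω ≠ ζ) :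
    min (height ω p ξ η).toReal (height ω p η ζ).toReal - (29 * δ + 10) ≤
      (height ω p ξ ζ).toReal := by
  have a := abs_le.1 (h.abs_toReal_height_sub_le hδ hX p h4 h5 h1)
  have b := abs_le.1 (h.abs_toReal_height_sub_le hδ hX p h5 h6 h2)
  have c := abs_le.1 (h.abs_toReal_height_sub_le hδ hX p h4 h6 h3)
  have d := h.toReal_boundaryProd_add_le hδ p h1 h2 h3 h4 h5 h6
  rcases min_le_iff.1 (sub_le_iff_le_add.1 d) with d | d
  · refine (sub_le_sub_right (min_le_left _ _) _).trans ?_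
    linarith
  · refine (sub_le_sub_right (min_le_right _ _) _).trans ?_
    linarith

end Hyperbolic

/-! ### Metrics built from chains. -/

/-- A function that is symmetric, vanishes exactly on the diagonal and is at most `C` times the
associated chain pseudometric gives rise to a metric. -/
theorem exists_metricSpace_of_le_chain {Z : Type u} (C : ℝ) (i : Z → Z → ℝ≥0)
    (hself : ∀ x, i x x = 0) (hcomm : ∀ x y, i x y = i y x) (hpos : ∀ x y, i x y = 0 → x = y)
    (hchain : ∀ x y, (i x y : ℝ) ≤ C * (PseudoMetricSpace.ofPreNNDist i hself hcomm).dist x y) :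
    ∃ d : MetricSpace Z, ∀ x y, (i x y : ℝ) ≤ C * d.dist x y ∧ d.dist x y ≤ i x y := by
  let P := PseudoMetricSpace.ofPreNNDist i hself hcomm
  refine ⟨{ P with eq_of_dist_eq_zero := ?_ }, fun x y => ⟨hchain x y, ?_⟩⟩
  · intro x y hxy
    have hxy' : P.dist x y = 0 := hxy
    have := hchain x y
    refine hpos x y (NNReal.coe_eq_zero.1 (le_antisymm ?_ (i x y).2))
    change (i x y : ℝ) ≤ C * P.dist x y at this
    rwa [hxy', mul_zero] at this
  · exact PseudoMetricSpace.dist_ofPreNNDist_le i hself hcomm x y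

/-- Frink's metrization: a function `h` that is ultrametric up to a small additive error is
comparable to `-log d / ε` for a metric `d`. -/
theorem exists_metricSpace_exp {Z : Type u} (h : Z → Z → ℝ) (hcomm : ∀ x y, h x y = h y x)
    {C ε : ℝ} (hε : 0 < ε) (hC : 0 ≤ C) (hεC : ε * C ≤ Real.log 2 / 2)
    (hmin : ∀ x y z, x ≠ y → y ≠ z → x ≠ z → min (h x y) (h y z) - C ≤ h x z) :
    ∃ d : MetricSpace Z, ∀ x y, x ≠ y →
      1 / 2 * Real.exp (-(ε * h x y)) ≤ d.dist x y ∧ d.dist x y ≤ Real.exp (-(ε * h x y)) := by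
  classical
  let i : Z → Z → ℝ≥0 := fun x y =>
    if x = y then 0 else ⟨Real.exp (-(ε * h x y)), (Real.exp_pos _).le⟩
  have hi : ∀ x y, x ≠ y → (i x y : ℝ) = Real.exp (-(ε * h x y)) := fun x y hxy => by
    rw [show i x y = ⟨Real.exp (-(ε * h x y)), (Real.exp_pos _).le⟩ from if_neg hxy]
    rfl
  have hself : ∀ x, i x x = 0 := fun x => by simp [i]
  have hsymm : ∀ x y, i x y = i y x := fun x y => by simp [i, hcomm x y, eq_comm]
  have hpos : ∀ x y, i x y = 0 → x = y := fun x y hxy => by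
    by_contra hne
    exact (Real.exp_pos _).ne' ((hi x y hne).symm.trans (NNReal.coe_eq_zero.2 hxy))
  have hK1 : 1 ≤ Real.exp (ε * C) := Real.one_le_exp (mul_nonneg hε.le hC)
  -- The bound log 2 / 2 is chosen for this: the four-point quasi-ultrametric inequality below uses
  -- the three-point one twice and must have constant at most 2.
  have hK2 : Real.exp (ε * C) * Real.exp (ε * C) ≤ 2 := by
    rw [← Real.exp_add, ← Real.le_log_iff_exp_le two_pos]
    linarith
  have htri : ∀ x y z, (i x z : ℝ) ≤ Real.exp (ε * C) * max (i x y : ℝ) (i y z) := by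
    intro x y z
    have hnn : ∀ a b, (0 : ℝ) ≤ i a b := fun a b => (i a b).2
    have hmx : (0 : ℝ) ≤ max (i x y : ℝ) (i y z) := (hnn x y).trans (le_max_left _ _)
    have hle : max (i x y : ℝ) (i y z) ≤ Real.exp (ε * C) * max (i x y : ℝ) (i y z) :=
      le_mul_of_one_le_left hmx hK1
    rcases eq_or_ne x y with rfl | hxy
    · exact (le_max_right _ _).trans hle
    rcases eq_or_ne y z with rfl | hyz
    · exact (le_max_left _ _).trans hle
    rcases eq_or_ne x z with rfl | hxz
    · rw [hself, NNReal.coe_zero]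
      exact mul_nonneg (Real.exp_pos _).le hmx
    have key : ∀ t : ℝ, t - C ≤ h x z →
        Real.exp (-(ε * h x z)) ≤ Real.exp (ε * C) * Real.exp (-(ε * t)) := by
      intro t ht
      rw [← Real.exp_add, Real.exp_le_exp]
      nlinarith
    rw [hi x z hxz, hi x y hxy, hi y z hyz]
    rcases min_le_iff.1 (sub_le_iff_le_add.1 (hmin x y z hxy hyz hxz)) with e | e
    · exact (key _ (by linarith)).trans
        (mul_le_mul_of_nonneg_left (le_max_left _ _) (Real.exp_pos _).le)
    · exact (key _ (by linarith)).trans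
        (mul_le_mul_of_nonneg_left (le_max_right _ _) (Real.exp_pos _).le)
  have hquad : ∀ x₁ x₂ x₃ x₄, i x₁ x₄ ≤ 2 * max (i x₁ x₂) (max (i x₂ x₃) (i x₃ x₄)) := by
    intro a b c e
    rw [← NNReal.coe_le_coe]
    push_cast
    have e1 := htri a b e
    have e2 := htri b c e
    set m := max (i a b : ℝ) (max (i b c : ℝ) (i c e))
    have hm : 0 ≤ m := (i a b).2.trans (le_max_left _ _)
    have e3 : max (i b c : ℝ) (i c e) ≤ m := le_max_right _ _
    have e4 : (i b e : ℝ) ≤ Real.exp (ε * C) * m :=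
      e2.trans (mul_le_mul_of_nonneg_left e3 (Real.exp_pos _).le)
    have e5 : max (i a b : ℝ) (i b e) ≤ Real.exp (ε * C) * m :=
      max_le ((le_max_left _ _).trans (le_mul_of_one_le_left hm hK1)) e4
    calc (i a e : ℝ) ≤ Real.exp (ε * C) * (Real.exp (ε * C) * m) :=
          e1.trans (mul_le_mul_of_nonneg_left e5 (Real.exp_pos _).le)
      _ = (Real.exp (ε * C) * Real.exp (ε * C)) * m := by ring
      _ ≤ 2 * m := mul_le_mul_of_nonneg_right hK2 hm
  obtain ⟨d, hd⟩ := exists_metricSpace_of_le_chain 2 i hself hsymm hpos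
    (PseudoMetricSpace.le_two_mul_dist_ofPreNNDist i hself hsymm hquad)
  refine ⟨d, fun x y hxy => ?_⟩
  obtain ⟨h1, h2⟩ := hd x y
  rw [hi x y hxy] at h1 h2
  exact ⟨by linarith, h2⟩

/-- A function `i x y = ρ x y * r x * r y`, with `ρ` satisfying the triangle inequality where
`r > 0`, is comparable to a metric if `|r x - r y| ≤ i x y ≤ r x + r y`. -/
theorem exists_metricSpace_of_weight {Z : Type u} (ρ : Z → Z → ℝ) (r : Z → ℝ)
    (i : Z → Z → ℝ) (hself : ∀ x, i x x = 0) (hcomm : ∀ x y, i x y = i y x)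
    (hpos : ∀ x y, i x y = 0 → x = y) (hr : ∀ x, 0 ≤ r x)
    (hlow : ∀ x y, r x - r y ≤ i x y) (hupp : ∀ x y, i x y ≤ r x + r y)
    (hρ : ∀ x y z, 0 < r x → 0 < r y → 0 < r z → ρ x z ≤ ρ x y + ρ y z)
    (hi : ∀ x y, 0 < r x → 0 < r y → i x y = ρ x y * (r x * r y)) :
    ∃ d : MetricSpace Z, ∀ x y, 1 / 4 * i x y ≤ d.dist x y ∧ d.dist x y ≤ i x y := by
  have hnn : ∀ x y, 0 ≤ i x y := fun x y => by
    linarith [hlow x y, hlow y x, hcomm x y]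
  let j : Z → Z → ℝ≥0 := fun x y => ⟨i x y, hnn x y⟩
  have hj : ∀ x y, (j x y : ℝ) = i x y := fun x y => rfl
  have hjself : ∀ x, j x x = 0 := fun x => NNReal.coe_eq_zero.1 (hself x)
  have hjcomm : ∀ x y, j x y = j y x := fun x y => NNReal.coe_injective (hcomm x y)
  have hlen : ∀ (l : List Z) (x y : Z), r x - r y ≤ ((x :: l).zipWith j (l ++ [y])).sum := by
    intro l
    induction l with
    | nil =>
      intro x y
      simpa [hj] using hlow x y
    | cons z l ih =>
      intro x y
      have := ih z y
      have := hlow x z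
      simp only [List.cons_append, List.zipWith_cons_cons, List.sum_cons, NNReal.coe_add, hj]
      linarith
  -- Either the chain reaches a point of weight below c, and then the differences of r along it sum
  -- to at least r x - c; or all weights are at least c, each link is at least c² ρ, and the
  -- triangle inequality for ρ applies.
  have hdich : ∀ (l : List Z) (c : ℝ) (x y : Z), 0 < c → c ≤ r x →
      (r x - c ≤ ((x :: l).zipWith j (l ++ [y])).sum ∨
        (c ≤ r y ∧ ρ x y * c ^ 2 ≤ ((x :: l).zipWith j (l ++ [y])).sum)) := by
    have hρnn : ∀ x y, 0 < r x → 0 < r y → 0 ≤ ρ x y := fun x y hx hy =>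
      nonneg_of_mul_nonneg_left ((hi x y hx hy) ▸ hnn x y) (mul_pos hx hy)
    have step : ∀ (c : ℝ) (x y : Z), 0 < c → c ≤ r x → c ≤ r y → ρ x y * c ^ 2 ≤ i x y := by
      intro c x y hc hx hy
      rw [hi x y (hc.trans_le hx) (hc.trans_le hy), sq]
      exact mul_le_mul_of_nonneg_left (mul_le_mul hx hy hc.le (hr x))
        (hρnn x y (hc.trans_le hx) (hc.trans_le hy))
    intro l
    induction l with
    | nil =>
      intro c x y hc hx
      have e : (((x :: []).zipWith j ([] ++ [y])).sum : ℝ) = i x y := by simp [hj]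
      rw [e]
      rcases le_or_gt c (r y) with hy | hy
      · exact Or.inr ⟨hy, step c x y hc hx hy⟩
      · exact Or.inl (by linarith [hlow x y])
    | cons z l ih =>
      intro c x y hc hx
      have e : (((x :: z :: l).zipWith j (z :: l ++ [y])).sum : ℝ) =
          i x z + ((z :: l).zipWith j (l ++ [y])).sum := by
        simp [hj]
      rw [e]
      rcases le_or_gt c (r z) with hz | hz
      · rcases ih c z y hc hz with h1 | ⟨h1, h2⟩
        · exact Or.inl (by linarith [hlow x z])
        · refine Or.inr ⟨h1, ?_⟩
          have := hρ x z y (hc.trans_le hx) (hc.trans_le hz) (hc.trans_le h1)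
          nlinarith [step c x z hc hx hz, sq_nonneg c]
      · refine Or.inl ?_
        have : (0 : ℝ) ≤ ((z :: l).zipWith j (l ++ [y])).sum := NNReal.coe_nonneg _
        linarith [hlow x z]
  have key : ∀ (l : List Z) (x y : Z), r y ≤ r x →
      i x y ≤ 4 * (((x :: l).zipWith j (l ++ [y])).sum : ℝ≥0) := by
    intro l x y hxy
    have hS : (0 : ℝ) ≤ (((x :: l).zipWith j (l ++ [y])).sum : ℝ≥0) := NNReal.coe_nonneg _
    have h1 : i x y ≤ 2 * r x := by linarith [hupp x y]
    rcases (hr x).eq_or_lt with h0 | h0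
    · linarith
    -- The threshold r x / 2 gives the factor 4 in both cases: i ≤ 2 r x against r x / 2, and i ≤ ρ
    -- (r x)² against ρ (r x / 2)².
    rcases hdich l (r x / 2) x y (half_pos h0) (half_le_self h0.le) with h2 | ⟨h2, h3⟩
    · linarith
    · have hy : 0 < r y := (half_pos h0).trans_le h2
      have h4 := hi x y h0 hy
      have h5 : 0 ≤ ρ x y := nonneg_of_mul_nonneg_left (h4 ▸ hnn x y) (mul_pos h0 hy)
      have h6 : ρ x y * (r x * r y) ≤ ρ x y * (r x * r x) :=
        mul_le_mul_of_nonneg_left (mul_le_mul_of_nonneg_left hxy h0.le) h5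
      linarith
  have hle : ∀ x y, r y ≤ r x →
      i x y ≤ 4 * (PseudoMetricSpace.ofPreNNDist j hjself hjcomm).dist x y := by
    intro x y hxy
    rw [show (PseudoMetricSpace.ofPreNNDist j hjself hjcomm).dist x y =
      ((⨅ l : List Z, ((x :: l).zipWith j (l ++ [y])).sum : ℝ≥0) : ℝ) from rfl]
    have : j x y ≤ 4 * ⨅ l : List Z, ((x :: l).zipWith j (l ++ [y])).sum := by
      rw [NNReal.mul_iInf]
      exact le_ciInf fun l => by
        rw [← NNReal.coe_le_coe]
        exact_mod_cast key l x y hxy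
    exact_mod_cast this
  obtain ⟨d, hd⟩ := exists_metricSpace_of_le_chain 4 j hjself hjcomm
    (fun x y hxy => hpos x y (NNReal.coe_eq_zero.2 hxy)) (fun x y => by
      rcases le_total (r y) (r x) with hxy | hxy
      · exact hle x y hxy
      · have := hle y x hxy
        rw [hj, hcomm]
        exact this.trans_eq (congrArg _ ((PseudoMetricSpace.ofPreNNDist j hjself hjcomm).dist_comm _ _)))
  refine ⟨d, fun x y => ?_⟩
  obtain ⟨h1, h2⟩ := hd x y
  rw [hj] at h1 h2
  exact ⟨by linarith, h2⟩

theorem exists_isMetricInversion {Y : Type u} (d : MetricSpace Y) (p : Y) :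
    ∃ d', IsMetricInversion d p d' := by
  have hpos : ∀ x : {x : Y // x ≠ p}, 0 < dist x.1 p := fun x => dist_pos.2 x.2
  obtain ⟨d', hd'⟩ := exists_metricSpace_of_weight (Z := {x : Y // x ≠ p})
    (fun x y => dist x.1 y.1) (fun x => 1 / dist x.1 p)
    (fun x y => dist x.1 y.1 / (dist x.1 p * dist y.1 p)) (by simp)
    (fun x y => by rw [dist_comm, mul_comm])
    (fun x y hxy => by
      have := (hpos x).ne'
      have := (hpos y).ne'
      rw [div_eq_zero_iff] at hxy
      rcases hxy with h | h
      · exact Subtype.ext (dist_eq_zero.1 h)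
      · simp_all)
    (fun x => by positivity)
    (fun x y => by
      have hx := hpos x
      have hy := hpos y
      rw [div_sub_div _ _ hx.ne' hy.ne']
      gcongr
      linarith [dist_triangle_left y.1 p x.1, dist_comm x.1 y.1])
    (fun x y => by
      have hx := hpos x
      have hy := hpos y
      rw [div_add_div _ _ hx.ne' hy.ne']
      gcongr
      linarith [dist_triangle_right x.1 y.1 p])
    (fun x y z _ _ _ => dist_triangle _ _ _)
    (fun x y _ _ => by
      rw [div_mul_div_comm, one_mul, mul_one_div])
  refine ⟨d', fun x y => ⟨le_trans (le_of_eq ?_) (hd' x y).1, (hd' x y).2⟩⟩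
  rw [div_mul_div_comm, one_mul, mul_assoc]

theorem exists_isSphericalization {Y : Type u} (d : MetricSpace Y) (p : Y) :
    ∃ d', IsSphericalization d p d' := by
  -- The value 0 of ρ at ∞ is arbitrary: the weight r vanishes there, and the conditions on ρ
  -- concern only points of positive weight.
  let ρ : OnePoint Y → OnePoint Y → ℝ
    | OnePoint.some x, OnePoint.some y => dist x y
    | _, _ => 0
  let r : OnePoint Y → ℝ
    | OnePoint.some x => 1 / (1 + dist x p)
    | OnePoint.infty => 0
  have hpos : ∀ x : Y, 0 < 1 + dist x p := fun x => by positivity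
  refine exists_metricSpace_of_weight ρ r (sphereFun d p) ?_ ?_ ?_ ?_ ?_ ?_ ?_ ?_
  · rintro (_ | x)
    · rfl
    · change dist x x / _ = 0
      simp
  · rintro (_ | x) (_ | y)
    · rfl
    · rfl
    · rfl
    · change dist x y / _ = dist y x / _
      rw [dist_comm, mul_comm]
  · rintro (_ | x) (_ | y) h
    · rfl
    · exact absurd h (one_div_pos.2 (hpos y)).ne'
    · exact absurd h (one_div_pos.2 (hpos x)).ne'
    · change dist x y / ((1 + dist x p) * (1 + dist y p)) = 0 at h
      rw [div_eq_zero_iff, or_iff_left (mul_pos (hpos x) (hpos y)).ne', dist_eq_zero] at h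
      rw [h]
  · rintro (_ | x)
    · exact le_rfl
    · exact (one_div_pos.2 (hpos x)).le
  · rintro (_ | x) (_ | y)
    · exact (sub_zero _).le
    · change 0 - 1 / (1 + dist y p) ≤ 1 / (1 + dist y p)
      linarith [one_div_pos.2 (hpos y)]
    · exact (sub_zero _).le
    · change 1 / (1 + dist x p) - 1 / (1 + dist y p) ≤ dist x y / _
      rw [div_sub_div _ _ (hpos x).ne' (hpos y).ne']
      gcongr
      linarith [dist_triangle_left y p x, dist_comm x y]
  · rintro (_ | x) (_ | y)
    · exact (add_zero _).ge
    · exact (zero_add _).ge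
    · exact (add_zero _).ge
    · change dist x y / _ ≤ 1 / (1 + dist x p) + 1 / (1 + dist y p)
      rw [div_add_div _ _ (hpos x).ne' (hpos y).ne']
      gcongr
      linarith [dist_triangle_right x y p]
  · rintro (_ | x) (_ | y) (_ | z) hx hy hz
    · exact absurd hx (lt_irrefl _)
    · exact absurd hx (lt_irrefl _)
    · exact absurd hx (lt_irrefl _)
    · exact absurd hx (lt_irrefl _)
    · exact absurd hy (lt_irrefl _)
    · exact absurd hy (lt_irrefl _)
    · exact absurd hz (lt_irrefl _)
    · exact dist_triangle x y z
  · rintro (_ | x) (_ | y) hx hy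
    · exact absurd hx (lt_irrefl _)
    · exact absurd hx (lt_irrefl _)
    · exact absurd hy (lt_irrefl _)
    · change dist x y / _ = dist x y * (1 / _ * (1 / _))
      rw [div_mul_div_comm, one_mul, mul_one_div]

/-! ### Coarse inversions: bilipschitz comparison, unboundedness, sphericalization. -/

section Metrics

variable {Y : Type u} {d : MetricSpace Y} {ξ : Y} {dpar : MetricSpace {η : Y // η ≠ ξ}} {M : ℝ}

/-- Up to the factor `M`, the metric `dpar` on `Y ∖ {ξ}` is the inversion of `d` at `ξ`. -/
def IsCoarseInversion (d : MetricSpace Y) (ξ : Y) (dpar : MetricSpace {η : Y // η ≠ ξ}) (M : ℝ) :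
    Prop :=
  ∀ x y : {η : Y // η ≠ ξ},
    dpar.dist x y ≤ M * (d.dist x.1 y.1 / (d.dist x.1 ξ * d.dist y.1 ξ)) ∧
      d.dist x.1 y.1 / (d.dist x.1 ξ * d.dist y.1 ξ) ≤ M * dpar.dist x y

theorem IsCoarseInversion.isBilipschitz (h : IsCoarseInversion d ξ dpar M) (hM : 1 ≤ M)
    {dinv : MetricSpace {η : Y // η ≠ ξ}} (hinv : IsMetricInversion d ξ dinv) :
    IsBilipschitz dpar dinv (4 * M) id := by
  intro x y
  obtain ⟨h1, h2⟩ := h x y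
  obtain ⟨h3, h4⟩ := hinv x y
  have hnn : 0 ≤ dpar.dist x y := @dist_nonneg _ dpar.toPseudoMetricSpace x y
  rw [mul_assoc, mul_comm (4 : ℝ), ← div_div] at h3
  simp only [id]
  constructor
  · rw [inv_mul_le_iff₀ (by positivity)]
    nlinarith
  · nlinarith

/-- Shows that d(x,ξ) is comparable to the weight 1/(1 + dpar(x,η)) of the sphericalization. Up to
the factor M, d(x,ξ) dpar(x,η) is d(x,η)/d(η,ξ). The upper bound uses diameter at most 1, the lower
one d(η,ξ) ≤ d(x,η) + d(x,ξ). -/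
theorem IsCoarseInversion.one_add_dist_bounds (h : IsCoarseInversion d ξ dpar M) (hM : 1 ≤ M)
    (hd : ∀ x y, d.dist x y ≤ 1) (η x : {η : Y // η ≠ ξ}) :
    1 ≤ (1 + M / d.dist η.1 ξ) * (d.dist x.1 ξ * (1 + dpar.dist x η)) ∧
      d.dist x.1 ξ * (1 + dpar.dist x η) ≤ 1 + M / d.dist η.1 ξ := by
  obtain ⟨h1, h2⟩ := h x η
  have ha : 0 < d.dist η.1 ξ := dist_pos.2 η.2
  have hx : 0 < d.dist x.1 ξ := dist_pos.2 x.2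
  have ha1 := hd η.1 ξ
  have hx1 := hd x.1 ξ
  have hxη := hd x.1 η.1
  have hxη0 : 0 ≤ d.dist x.1 η.1 := dist_nonneg
  have htri : d.dist η.1 ξ ≤ d.dist x.1 η.1 + d.dist x.1 ξ := dist_triangle_left _ _ _
  set a := d.dist η.1 ξ
  set b := d.dist x.1 ξ
  set c := d.dist x.1 η.1
  set e := dpar.dist x η
  have h1' : b * e ≤ M * c / a := by
    calc b * e ≤ b * (M * (c / (b * a))) := mul_le_mul_of_nonneg_left h1 hx.le
      _ = M * c / a := by field_simp
  have h2' : c / a ≤ M * (b * e) := by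
    calc c / a = b * (c / (b * a)) := by field_simp
      _ ≤ b * (M * e) := mul_le_mul_of_nonneg_left h2 hx.le
      _ = M * (b * e) := by ring
  have h3 : c ≤ c / a := le_div_self hxη0 ha ha1
  have h4 : 0 ≤ M * (b * e) := (hxη0.trans h3).trans h2'
  have h5 : a ≤ M * (b * (1 + e)) := by nlinarith
  have h6 : 0 ≤ b * (1 + e) := by nlinarith
  constructor
  · have : 1 ≤ M / a * (b * (1 + e)) := by
      rw [div_mul_eq_mul_div, one_le_div ha]
      exact h5
    linarith
  · have : M * c / a ≤ M / a := div_le_div_of_nonneg_right (by nlinarith) ha.le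
    linarith

theorem IsCoarseInversion.isUnbounded (h : IsCoarseInversion d ξ dpar M) (hM : 1 ≤ M)
    (η : {η : Y // η ≠ ξ}) (hξ : ∀ r > 0, ∃ ζ, ζ ≠ ξ ∧ d.dist ζ ξ < r) : IsUnbounded dpar := by
  intro R
  have ha : 0 < d.dist η.1 ξ := dist_pos.2 η.2
  have hQ : 0 < 2 * (M * (|R| + 1)) := by positivity
  -- The first bound keeps d(ζ,η) above d(η,ξ)/2; the second then pushes the inversion quotient
  -- above M(|R| + 1).
  obtain ⟨ζ, hζ, hlt⟩ := hξ (min (d.dist η.1 ξ / 2) (1 / (2 * (M * (|R| + 1)))))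
    (lt_min (half_pos ha) (one_div_pos.2 hQ))
  obtain ⟨h1, h2⟩ := lt_min_iff.1 hlt
  refine ⟨⟨ζ, hζ⟩, η, ?_⟩
  have h3 := (h ⟨ζ, hζ⟩ η).2
  have hb : 0 < d.dist ζ ξ := dist_pos.2 hζ
  have htri : d.dist η.1 ξ ≤ d.dist ζ η.1 + d.dist ζ ξ := dist_triangle_left _ _ _
  simp only at h3
  set a := d.dist η.1 ξ
  set b := d.dist ζ ξ
  rw [lt_div_iff₀ hQ] at h2
  have h4 : M * (|R| + 1) ≤ d.dist ζ η.1 / (b * a) := by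
    rw [le_div_iff₀ (mul_pos hb ha)]
    nlinarith
  have h5 : |R| + 1 ≤ dpar.dist ⟨ζ, hζ⟩ η :=
    le_of_mul_le_mul_left (h4.trans h3) (by linarith)
  linarith [le_abs_self R]

/-- Replacing both weights by d(x,ξ) and d(y,ξ) costs A each and cancels the denominators of the
inversion, which costs M; the sphericalization itself costs 4. -/
theorem IsCoarseInversion.isBilipschitz_toSphere (h : IsCoarseInversion d ξ dpar M) (hM : 1 ≤ M)
    (hd : ∀ x y, d.dist x y ≤ 1) {η : {η : Y // η ≠ ξ}}
    {dsph : MetricSpace (OnePoint {η : Y // η ≠ ξ})} (hsph : IsSphericalization dpar η dsph) :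
    ∃ L', 1 ≤ L' ∧ IsBilipschitz d dsph L' (toSphere ξ) := by
  have ha : 0 < d.dist η.1 ξ := dist_pos.2 η.2
  set A := 1 + M / d.dist η.1 ξ with hA
  have hA1 : 1 ≤ A := by
    have : 0 ≤ M / d.dist η.1 ξ := by positivity
    linarith
  have hL1 : 1 ≤ M * A ^ 2 := one_le_mul_of_one_le_of_one_le hM (one_le_pow₀ hA1)
  have hAL : A ≤ M * A ^ 2 := by nlinarith [mul_le_mul hM hA1 zero_le_one (zero_le_one.trans hM)]
  have hL0 : 0 < M * A ^ 2 := zero_lt_one.trans_le hL1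
  have hinf : ∀ x : {η : Y // η ≠ ξ}, 1 / (1 + dpar.dist x η) ≤ M * A ^ 2 * d.dist x.1 ξ ∧
      d.dist x.1 ξ ≤ M * A ^ 2 * (1 / (1 + dpar.dist x η)) := by
    intro x
    obtain ⟨h1, h2⟩ := h.one_add_dist_bounds hM hd η x
    have hx : 0 < d.dist x.1 ξ := dist_pos.2 x.2
    have hw : 0 < 1 + dpar.dist x η := by
      have : 0 ≤ dpar.dist x η := @dist_nonneg _ dpar.toPseudoMetricSpace x η
      linarith
    constructor
    · rw [div_le_iff₀ hw]
      have := mul_le_mul_of_nonneg_right hAL (mul_pos hx hw).le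
      linarith
    · rw [mul_one_div, le_div_iff₀ hw]
      linarith
  have hfin : ∀ x y : {η : Y // η ≠ ξ},
      dpar.dist x y / ((1 + dpar.dist x η) * (1 + dpar.dist y η)) ≤
        M * A ^ 2 * d.dist x.1 y.1 ∧
      d.dist x.1 y.1 ≤
        M * A ^ 2 * (dpar.dist x y / ((1 + dpar.dist x η) * (1 + dpar.dist y η))) := by
    intro x y
    obtain ⟨h1, h2⟩ := h.one_add_dist_bounds hM hd η x
    obtain ⟨h3, h4⟩ := h.one_add_dist_bounds hM hd η y
    obtain ⟨h5, h6⟩ := h x y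
    have hx : 0 < d.dist x.1 ξ := dist_pos.2 x.2
    have hy : 0 < d.dist y.1 ξ := dist_pos.2 y.2
    have hwx : 0 < 1 + dpar.dist x η := by
      have : 0 ≤ dpar.dist x η := @dist_nonneg _ dpar.toPseudoMetricSpace x η
      linarith
    have hwy : 0 < 1 + dpar.dist y η := by
      have : 0 ≤ dpar.dist y η := @dist_nonneg _ dpar.toPseudoMetricSpace y η
      linarith
    have hdxy : 0 ≤ d.dist x.1 y.1 := dist_nonneg
    have hpxy : 0 ≤ dpar.dist x y := @dist_nonneg _ dpar.toPseudoMetricSpace x y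
    rw [← mul_div_assoc, le_div_iff₀ (mul_pos hx hy)] at h5
    rw [div_le_iff₀ (mul_pos hx hy)] at h6
    rw [← hA] at h1 h2 h3 h4
    set u := d.dist x.1 ξ
    set v := d.dist y.1 ξ
    set s := 1 + dpar.dist x η
    set t := 1 + dpar.dist y η
    have hus := mul_pos hx hwx
    have hvt := mul_pos hy hwy
    have hlow : 1 ≤ A ^ 2 * ((u * s) * (v * t)) := by
      have := one_le_mul_of_one_le_of_one_le h1 h3
      linarith
    have hupp : (u * s) * (v * t) ≤ A ^ 2 := by
      rw [sq]
      exact mul_le_mul h2 h4 hvt.le (zero_le_one.trans hA1)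
    constructor
    · rw [div_le_iff₀ (mul_pos hwx hwy)]
      have e1 := mul_le_mul_of_nonneg_left hlow hpxy
      have e2 := mul_le_mul_of_nonneg_left h5 (mul_pos (pow_pos (zero_lt_one.trans_le hA1) 2)
        (mul_pos hwx hwy)).le
      linarith
    · rw [← mul_div_assoc, le_div_iff₀ (mul_pos hwx hwy)]
      have e1 := mul_le_mul_of_nonneg_right h6 (mul_pos hwx hwy).le
      have e2 := mul_le_mul_of_nonneg_left hupp (mul_nonneg (zero_le_one.trans hM) hpxy)
      linarith
  have key : ∀ x y : Y,
      sphereFun dpar η (toSphere ξ x) (toSphere ξ y) ≤ M * A ^ 2 * d.dist x y ∧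
      d.dist x y ≤ M * A ^ 2 * sphereFun dpar η (toSphere ξ x) (toSphere ξ y) := by
    intro x y
    have htop : toSphere ξ ξ = OnePoint.infty := dif_pos rfl
    have hsome : ∀ (ζ : Y) (hζ : ζ ≠ ξ), toSphere ξ ζ = OnePoint.some ⟨ζ, hζ⟩ :=
      fun ζ hζ => dif_neg hζ
    rcases eq_or_ne x ξ with hx | hx <;> rcases eq_or_ne y ξ with hy | hy
    · rw [hx, hy, htop, show d.dist ξ ξ = 0 from dist_self ξ]
      simp [sphereFun]
    · rw [hx, htop, hsome y hy, show d.dist ξ y = d.dist y ξ from dist_comm ξ y]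
      exact hinf ⟨y, hy⟩
    · rw [hy, htop, hsome x hx]
      exact hinf ⟨x, hx⟩
    · rw [hsome x hx, hsome y hy]
      exact hfin ⟨x, hx⟩ ⟨y, hy⟩
  refine ⟨4 * (M * A ^ 2), by linarith, fun x y => ?_⟩
  obtain ⟨h1, h2⟩ := key x y
  obtain ⟨h3, h4⟩ := hsph (toSphere ξ x) (toSphere ξ y)
  have hdxy : 0 ≤ d.dist x y := dist_nonneg
  constructor
  · rw [inv_mul_le_iff₀ (by linarith)]
    have := mul_le_mul_of_nonneg_left h3 hL0.le
    linarith
  · have := mul_nonneg hL0.le hdxy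
    linarith

end Metrics

/-! ### Visual and parabolic visual metrics. -/

theorem expNeg_coe (ε a : ℝ) : expNeg ε (a : EReal) = Real.exp (-(ε * a)) := by
  rw [expNeg, ← EReal.coe_mul, ← EReal.coe_neg, EReal.exp_coe,
    ENNReal.toReal_ofReal (Real.exp_pos _).le]

theorem expNeg_top {ε : ℝ} (hε : 0 < ε) : expNeg ε ⊤ = 0 := by
  rw [expNeg, EReal.coe_mul_top_of_pos hε, EReal.neg_top, EReal.exp_bot, ENNReal.toReal_zero]

section Space

variable {X : Type u} [MetricSpace X] {δ ε : ℝ} {p : X} {ξ : Boundary X}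

theorem IsHyperbolic.expNeg_boundaryProd (h : IsHyperbolic X δ) (hδ : 0 ≤ δ) (p : X) (ε : ℝ)
    {η ζ : Boundary X} (hne : η ≠ ζ) :
    expNeg ε (boundaryProd p η ζ) = Real.exp (-(ε * (boundaryProd p η ζ).toReal)) := by
  rw [← expNeg_coe, h.coe_toReal_boundaryProd hδ p hne]

theorem IsHyperbolic.exists_isVisualMetric (h : IsHyperbolic X δ) (hδ : 0 ≤ δ) (p : X)
    (hε : 0 < ε) (hε' : ε * (5 * δ + 2) ≤ Real.log 2 / 2) : ∃ d, IsVisualMetric p ε d := by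
  obtain ⟨d, hd⟩ := exists_metricSpace_exp (fun η ζ : Boundary X => (boundaryProd p η ζ).toReal)
    (fun η ζ => by rw [boundaryProd_comm]) hε (by linarith) hε'
    (fun x y z => h.min_toReal_boundaryProd_le hδ p)
  refine ⟨d, fun η ζ => ?_⟩
  -- The diagonal is separate: there the product is ⊤, so its `toReal` carries no information.
  rcases eq_or_ne η ζ with rfl | hne
  · rw [boundaryProd_self, expNeg_top hε, show d.dist η η = 0 from dist_self η]
    simp
  · rw [h.expNeg_boundaryProd hδ p ε hne]
    exact hd η ζ hne

theorem IsHyperbolic.exists_isParabolicVisualMetric [ProperSpace X] (h : IsHyperbolic X δ)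
    (hδ : 0 ≤ δ) (hX : IsGeodesicSpace X) (ξ : Boundary X) (p : X) (hε : 0 < ε)
    (hε' : ε * (29 * δ + 10) ≤ Real.log 2 / 2) : ∃ d, IsParabolicVisualMetric ξ p ε d := by
  obtain ⟨d, hd⟩ := exists_metricSpace_exp
    (fun η ζ : {η : Boundary X // η ≠ ξ} => (height ξ p η ζ).toReal)
    (fun η ζ => by rw [height_comm]) hε (by linarith) hε'
    (fun x y z h1 h2 h3 => h.min_toReal_height_le hδ hX p (Subtype.coe_injective.ne h1)
      (Subtype.coe_injective.ne h2) (Subtype.coe_injective.ne h3) x.2.symm y.2.symm z.2.symm)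
  refine ⟨d, fun η ζ hne => ?_⟩
  rw [← h.coe_toReal_height hδ hX p η.2.symm ζ.2.symm (Subtype.coe_injective.ne hne), expNeg_coe]
  exact hd η ζ hne

theorem IsVisualMetric.dist_le_one {d : MetricSpace (Boundary X)} (hd : IsVisualMetric p ε d)
    (h : IsHyperbolic X δ) (hδ : 0 ≤ δ) (hε : 0 < ε) (η ζ : Boundary X) : d.dist η ζ ≤ 1 := by
  refine (hd η ζ).2.trans ?_
  rcases eq_or_ne η ζ with rfl | hne
  · rw [boundaryProd_self, expNeg_top hε]
    exact zero_le_one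
  · rw [h.expNeg_boundaryProd hδ p ε hne, Real.exp_le_one_iff, neg_nonpos]
    exact mul_nonneg hε.le (EReal.toReal_nonneg (boundaryProd_nonneg p η ζ))

theorem IsVisualMetric.exists_dist_lt {d : MetricSpace (Boundary X)} (hd : IsVisualMetric p ε d)
    (h : IsHyperbolic X δ) (hδ : 0 ≤ δ) (hε : 0 < ε) (hξ : IsNonIsolated ξ) {r : ℝ} (hr : 0 < r) :
    ∃ ζ, ζ ≠ ξ ∧ d.dist ζ ξ < r := by
  obtain ⟨ζ, hne, hζ⟩ := hξ p (-Real.log r / ε)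
  refine ⟨ζ, hne, (hd ζ ξ).2.trans_lt ?_⟩
  rw [boundaryProd_comm] at hζ
  rw [← h.coe_toReal_boundaryProd hδ p hne, EReal.coe_lt_coe_iff, div_lt_iff₀ hε] at hζ
  rw [h.expNeg_boundaryProd hδ p ε hne, ← Real.lt_log_iff_exp_lt hr]
  linarith

/-- A parabolic visual metric is, up to a bounded factor, the inversion of a visual metric. -/
theorem IsParabolicVisualMetric.isCoarseInversion [ProperSpace X]
    {dpar : MetricSpace {η : Boundary X // η ≠ ξ}} {dvis : MetricSpace (Boundary X)}
    (hpar : IsParabolicVisualMetric ξ p ε dpar) (hvis : IsVisualMetric p ε dvis)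
    (h : IsHyperbolic X δ) (hδ : 0 ≤ δ) (hX : IsGeodesicSpace X) {ε₀ : ℝ} (hε : 0 < ε)
    (hε₀ : ε ≤ ε₀) :
    IsCoarseInversion dvis ξ dpar (8 * Real.exp (ε₀ * (10 * δ + 3))) := by
  intro x y
  rcases eq_or_ne x y with rfl | hxy
  · rw [show dpar.dist x x = 0 from @dist_self _ dpar.toPseudoMetricSpace x,
      show dvis.dist x.1 x.1 = 0 from dist_self x.1]
    simp
  have hne : x.1 ≠ y.1 := Subtype.coe_injective.ne hxy
  have hH := abs_le.1 (h.abs_toReal_height_sub_le hδ hX p x.2.symm y.2.symm hne)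
  obtain ⟨p1, p2⟩ := hpar x y hxy
  rw [← h.coe_toReal_height hδ hX p x.2.symm y.2.symm hne, expNeg_coe] at p1 p2
  obtain ⟨a1, a2⟩ := hvis x.1 y.1
  obtain ⟨b1, b2⟩ := hvis x.1 ξ
  obtain ⟨c1, c2⟩ := hvis y.1 ξ
  rw [h.expNeg_boundaryProd hδ p ε hne] at a1 a2
  rw [boundaryProd_comm, h.expNeg_boundaryProd hδ p ε x.2.symm] at b1 b2
  rw [boundaryProd_comm, h.expNeg_boundaryProd hδ p ε y.2.symm] at c1 c2
  have hb : 0 < dvis.dist x.1 ξ := dist_pos.2 x.2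
  have hc : 0 < dvis.dist y.1 ξ := dist_pos.2 y.2
  -- Passing to ε₀ makes the constant independent of ε.
  have hεC : ε * (10 * δ + 3) ≤ ε₀ * (10 * δ + 3) :=
    mul_le_mul_of_nonneg_right hε₀ (by linarith)
  set H := (height ξ p x.1 y.1).toReal
  set G := (boundaryProd p x.1 y.1).toReal
  set Gx := (boundaryProd p ξ x.1).toReal
  set Gy := (boundaryProd p ξ y.1).toReal
  set K := Real.exp (ε₀ * (10 * δ + 3)) with hK
  have k1 : Real.exp (-(ε * H)) * (Real.exp (-(ε * Gx)) * Real.exp (-(ε * Gy))) ≤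
      K * Real.exp (-(ε * G)) := by
    rw [hK, ← Real.exp_add, ← Real.exp_add, ← Real.exp_add, Real.exp_le_exp]
    nlinarith [mul_le_mul_of_nonneg_left hH.1 hε.le]
  have k2 : Real.exp (-(ε * G)) ≤
      K * (Real.exp (-(ε * H)) * (Real.exp (-(ε * Gx)) * Real.exp (-(ε * Gy)))) := by
    rw [hK, ← Real.exp_add, ← Real.exp_add, ← Real.exp_add, Real.exp_le_exp]
    nlinarith [mul_le_mul_of_nonneg_left hH.2 hε.le]
  have hK0 : 0 < K := Real.exp_pos _
  have hE : 0 < Real.exp (-(ε * H)) := Real.exp_pos _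
  have hu : 0 < Real.exp (-(ε * G)) := Real.exp_pos _
  have hv : 0 < Real.exp (-(ε * Gx)) := Real.exp_pos _
  have hw : 0 < Real.exp (-(ε * Gy)) := Real.exp_pos _
  set E := Real.exp (-(ε * H))
  set u := Real.exp (-(ε * G))
  set v := Real.exp (-(ε * Gx))
  set w := Real.exp (-(ε * Gy))
  have m1 : dvis.dist x.1 ξ * dvis.dist y.1 ξ ≤ v * w := mul_le_mul b2 c2 hc.le hv.le
  have m2 : 1 / 4 * (v * w) ≤ dvis.dist x.1 ξ * dvis.dist y.1 ξ := by
    have := mul_le_mul b1 c1 (by positivity) hb.le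
    linarith
  have hm := mul_pos hb hc
  set m := dvis.dist x.1 ξ * dvis.dist y.1 ξ
  constructor
  · rw [← mul_div_assoc, le_div_iff₀ hm]
    have e1 : dpar.dist x y * m ≤ E * (v * w) := mul_le_mul p2 m1 hm.le hE.le
    have e2 : K * u ≤ 2 * (K * dvis.dist x.1 y.1) := by
      have := mul_le_mul_of_nonneg_left a1 hK0.le
      linarith
    have e3 : 0 < K * u := mul_pos hK0 hu
    linarith
  -- This direction needs the 8: a factor 2 is lost for the parabolic metric and 2 for each of the
  -- two visual distances to ξ.
  · rw [div_le_iff₀ hm]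
    have e1 : 1 / 2 * E * (1 / 4 * (v * w)) ≤ dpar.dist x y * m :=
      mul_le_mul p1 m2 (by positivity) (le_trans (by positivity) p1)
    have e2 := mul_le_mul_of_nonneg_left e1 hK0.le
    linarith

end Space

end ParabolicVisual

end

/-! ### The proposition. -/

open ParabolicVisual
theorem proposition5p4 (δ : ℝ) (hδ : 0 ≤ δ) :
    -- for small `ε`, visual metrics and parabolic visual metrics exist
    (∃ ε₀ : ℝ, 0 < ε₀ ∧
      ∀ (X : Type*) [MetricSpace X] [ProperSpace X], IsGeodesicSpace X → IsHyperbolic X δ →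
        ∀ (ξ : Boundary X) (p : X) (ε : ℝ), 0 < ε → ε ≤ ε₀ →
          (∃ dpar, IsParabolicVisualMetric ξ p ε dpar) ∧ (∃ dvis, IsVisualMetric p ε dvis)) ∧
    -- and, in any bounded range of `ε`, all of them are related as follows
    (∀ ε₀ : ℝ, 0 < ε₀ → ∃ L : ℝ, 1 ≤ L ∧
      ∀ (X : Type*) [MetricSpace X] [ProperSpace X], IsGeodesicSpace X → IsHyperbolic X δ →
        ∀ (ξ : Boundary X) (p : X) (ε : ℝ), 0 < ε → ε ≤ ε₀ →
        ∀ (dpar : MetricSpace {η : Boundary X // η ≠ ξ}) (dvis : MetricSpace (Boundary X)),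
          IsParabolicVisualMetric ξ p ε dpar → IsVisualMetric p ε dvis →
          ((∃ dinv, IsMetricInversion dvis ξ dinv) ∧
            ∀ dinv, IsMetricInversion dvis ξ dinv → IsBilipschitz dpar dinv L id) ∧
          (IsNonIsolated ξ → ∀ η : {η : Boundary X // η ≠ ξ},
            IsUnbounded dpar ∧
            (∃ dsph, IsSphericalization dpar η dsph) ∧
            ∀ dsph, IsSphericalization dpar η dsph →
              ∃ L' : ℝ, 1 ≤ L' ∧ IsBilipschitz dvis dsph L' (toSphere ξ))) := by
  -- The error 29δ + 10 for heights dominates the error 5δ + 2 for boundary products, so one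
  -- threshold serves both metrics.
  refine ⟨⟨Real.log 2 / 2 / (29 * δ + 10), by positivity, ?_⟩, fun ε₀ hε₀ => ?_⟩
  · intro X _ _ hX h ξ p ε hε hε'
    rw [le_div_iff₀ (by positivity)] at hε'
    refine ⟨h.exists_isParabolicVisualMetric hδ hX ξ p hε hε',
      h.exists_isVisualMetric hδ p hε (le_trans ?_ hε')⟩
    exact mul_le_mul_of_nonneg_left (by linarith) hε.le
  · have hM : 1 ≤ 8 * Real.exp (ε₀ * (10 * δ + 3)) := by
      have := Real.one_le_exp (show 0 ≤ ε₀ * (10 * δ + 3) by positivity)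
      linarith
    refine ⟨4 * (8 * Real.exp (ε₀ * (10 * δ + 3))), by linarith, ?_⟩
    intro X _ _ hX h ξ p ε hε hε' dpar dvis hpar hvis
    have hco := hpar.isCoarseInversion hvis h hδ hX hε hε'
    refine ⟨⟨exists_isMetricInversion dvis ξ, fun dinv hinv => hco.isBilipschitz hM hinv⟩,
      fun hξ η => ⟨hco.isUnbounded hM η fun r hr => hvis.exists_dist_lt h hδ hε hξ hr,
        exists_isSphericalization dpar η, fun dsph hsph => ?_⟩⟩
    exact hco.isBilipschitz_toSphere hM (hvis.dist_le_one h hδ hε) hsph
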